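/- Let $G$ be a 3-dimensional Lie group, let $I\subset\mathbb R$ be a nonempty open interval, and let $e^1(t),e^2(t),e^3(t)$, $t\in I$, be 1-forms on $G$ (not necessarily left-invariant), depending smoothly on $(x,t)\in G\times I$, which form a global basis of 1-forms on $G$ for each $t\in I$. Let $f:I\to\mathbb R$ be a smooth nowhere vanishing function. Write $e^{ij}(t)=e^i(t)\wedge e^j(t)$, and let $d$ be the exterior derivative on $G$. Consider on $M=G\times I$ the 2-forms $$F_1=e^{12}(t)+e^3(t)\wedge f(t)\,dt,\qquad F_2=e^{13}(t)-e^2(t)\wedge f(t)\,dt,\qquad F_3=e^{23}(t)+e^1(t)\wedge f(t)\,dt .$$ An almost hyper-Hermitian structure on $M$ is a Riemannian metric $g$ with almost complex structures $J_1,J_2,J_3$ that are isometries of $g$ and satisfy $J_1J_2=-J_2J_1=J_3$; its fundamental 2-forms are $g(J_s\cdot,\cdot)$, $s=1,2,3$; it is hyper-Kähler if $J_1,J_2,J_3$ are parallel with respect to the Levi-Civita connection of $g$. There is exactly one almost hyper-Hermitian structure $(g,J_1,J_2,J_3)$ on $M$ whose fundamental 2-forms are $F_1,F_2,F_3$. It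 is hyper-Kähler if and only if $$de^{12}(t_0)=de^{13}(t_0)=de^{23}(t_0)=0\quad\text{for some }t_0\in I,$$ and the evolution equations $$\frac{\partial}{\partial t}e^{ij}(t)=-f(t)\,de^k(t)$$ hold for all $t\in I$ and all even permutations $(i,j,k)$ of $(1,2,3)$. Its metric is $$g=(e^1(t))^2+(e^2(t))^2+(e^3(t))^2+f(t)^2\,dt^2 .$$ -/

import Mathlib

open Bundle Set TopologicalSpace
open scoped Manifold ContDiff

/-! ### Differential forms -/

/-- The wedge product of two 1-forms on a vector space:
`(α ∧ β)(v, w) = α(v) β(w) - α(w) β(v)`. -/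
def wedge {V : Type*} [AddCommGroup V] [Module ℝ V] [TopologicalSpace V]
    (α β : V →L[ℝ] ℝ) : V [⋀^Fin 2]→L[ℝ] ℝ where
  toFun v := α (v 0) * β (v 1) - α (v 1) * β (v 0)
  map_update_add' {inst} v i x y := by
    obtain rfl : inst = instDecidableEqFin 2 := Subsingleton.elim _ _
    fin_cases i <;> simp <;> ring
  map_update_smul' {inst} v i c x := by
    obtain rfl : inst = instDecidableEqFin 2 := Subsingleton.elim _ _
    fin_cases i <;> simp <;> ring
  cont := by fun_prop
  map_eq_zero_of_eq' v i j hij hne := by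
    fin_cases i <;> fin_cases j <;> simp_all

/-- A 1-form seen as an alternating form of degree 1. -/
def toOneForm {V : Type*} [AddCommGroup V] [Module ℝ V] [TopologicalSpace V]
    (α : V →L[ℝ] ℝ) : V [⋀^Fin 1]→L[ℝ] ℝ :=
  ContinuousAlternatingMap.ofSubsingleton ℝ V ℝ (0 : Fin 1) α

section Manifold

variable {E : Type*} [NormedAddCommGroup E] [NormedSpace ℝ E]
  {H : Type*} [TopologicalSpace H] (I : ModelWithCorners ℝ E H)
  {M : Type*} [TopologicalSpace M] [ChartedSpace H M]

/-- The exterior derivative of a differential `n`-form on a manifold: at `x₀`, the form is pulled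
back to the model vector space by the inverse of the preferred chart at `x₀`, differentiated there,
and the result is pulled back to the tangent space at `x₀` by the chart. -/
noncomputable def mextDeriv {n : ℕ} (α : ∀ x : M, TangentSpace I x [⋀^Fin n]→L[ℝ] ℝ) (x₀ : M) :
    TangentSpace I x₀ [⋀^Fin (n + 1)]→L[ℝ] ℝ :=
  (extDerivWithin (E := E)
    (fun y : E ↦ (α ((extChartAt I x₀).symm y)).compContinuousLinearMap
      (mfderivWithin 𝓘(ℝ, E) I (extChartAt I x₀).symm (range I) y))
    (range I) (extChartAt I x₀ x₀)).compContinuousLinearMap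
      (mfderiv I 𝓘(ℝ, E) (extChartAt I x₀) x₀)

variable (M) in
/-- An almost hyper-Hermitian structure: a smooth Riemannian metric `g` and three smooth fields of
`g`-isometric almost complex structures `J₁ = J 0`, `J₂ = J 1`, `J₃ = J 2` satisfying
`J₁ J₂ = - J₂ J₁ = J₃`. -/
structure AlmostHyperHermitian [IsManifold I ∞ M] where
  metric : ContMDiffRiemannianMetric I ∞ E (fun x : M ↦ TangentSpace I x)
  J : Fin 3 → ∀ x : M, TangentSpace I x →L[ℝ] TangentSpace I x
  smooth_J : ∀ s, ContMDiff I (I.prod 𝓘(ℝ, E →L[ℝ] E)) ∞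
    (fun x : M ↦ TotalSpace.mk' (E →L[ℝ] E)
      (E := fun x : M ↦ TangentSpace I x →L[ℝ] TangentSpace I x) x (J s x))
  J_sq : ∀ s x v, J s x (J s x v) = -v
  J_mul : ∀ x v, J 0 x (J 1 x v) = J 2 x v
  J_anticomm : ∀ x v, J 1 x (J 0 x v) = - J 2 x v
  isometry : ∀ s x v w, metric.inner x (J s x v) (J s x w) = metric.inner x v w

/-- `cov` is the Levi-Civita connection of the metric `g`: torsion-free and `∇ g = 0`. -/
def IsLeviCivita [FiniteDimensional ℝ E] [IsManifold I ∞ M]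
    (g : ContMDiffRiemannianMetric I ∞ E (fun x : M ↦ TangentSpace I x))
    (cov : CovariantDerivative I E (fun x : M ↦ TangentSpace I x)) : Prop :=
  haveI : IsManifold I 2 M := inferInstance
  cov.torsion = 0 ∧
  ∀ (x : M) (Y Z : ∀ x : M, TangentSpace I x), MDiffAt (T% Y) x → MDiffAt (T% Z) x →
    ∀ v : TangentSpace I x, mvfderiv I (fun y ↦ g.inner y (Y y) (Z y)) x v =
      g.inner x (cov Y x v) (Z x) + g.inner x (Y x) (cov Z x v)

/-- The field of endomorphisms `A` is parallel, `∇ A = 0`: that is, `∇_v (A Y) = A (∇_v Y)`. -/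
def IsParallelEndo [IsManifold I ∞ M]
    (cov : CovariantDerivative I E (fun x : M ↦ TangentSpace I x))
    (A : ∀ x : M, TangentSpace I x →L[ℝ] TangentSpace I x) : Prop :=
  ∀ (x : M) (Y : ∀ x : M, TangentSpace I x), MDiffAt (T% Y) x →
    ∀ v : TangentSpace I x, cov (fun y ↦ A y (Y y)) x v = A x (cov Y x v)

variable {I} in
/-- The fundamental 2-forms `F_s(v, w) = g(J_s v, w)`. -/
noncomputable def AlmostHyperHermitian.fundamentalForm [IsManifold I ∞ M] (S : AlmostHyperHermitian I M)
    (s : Fin 3) (x : M) (v w : TangentSpace I x) : ℝ :=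
  S.metric.inner x (S.J s x v) w

variable {I} in
/-- Hyper-Kähler: the three almost complex structures are parallel with respect to the Levi-Civita
connection of the metric. -/
def AlmostHyperHermitian.IsHyperKahler [FiniteDimensional ℝ E] [IsManifold I ∞ M]
    (S : AlmostHyperHermitian I M) : Prop :=
  ∃ cov : CovariantDerivative I E (fun x : M ↦ TangentSpace I x),
    IsLeviCivita I S.metric cov ∧ ∀ s, IsParallelEndo I cov (S.J s)

end Manifold

/-! ### The forms on `G × I` built from a time-dependent coframe on `G` -/

section Evolution

variable {G : Type*} [TopologicalSpace G] [ChartedSpace (EuclideanSpace ℝ (Fin 3)) G]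

/-- A smooth time-dependent global coframe on the 3-manifold `G`, `t` in the open set `I`: for
`t ∈ I` the 1-forms `e 0 t, e 1 t, e 2 t` depend smoothly on `(x, t) ∈ G × I` and are linearly
independent, hence a basis of the 3-dimensional cotangent space, at every point. -/
structure IsSmoothCoframe [IsManifold (𝓡 3) ∞ G] (I : Opens ℝ)
    (e : Fin 3 → ℝ → ∀ x : G, TangentSpace (𝓡 3) x →L[ℝ] ℝ) : Prop where
  smooth : ∀ i, ContMDiff ((𝓡 3).prod 𝓘(ℝ, ℝ))
    ((𝓡 3).prod 𝓘(ℝ, EuclideanSpace ℝ (Fin 3) →L[ℝ] ℝ)) ∞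
    (fun p : G × I ↦ TotalSpace.mk' (EuclideanSpace ℝ (Fin 3) →L[ℝ] ℝ)
      (E := fun x : G ↦ TangentSpace (𝓡 3) x →L[ℝ] Trivial G ℝ x) p.1 (e i p.2 p.1))
  basis : ∀ t ∈ I, ∀ x : G, LinearIndependent ℝ (fun i ↦ e i t x)

variable {I : Opens ℝ}

/-- The 1-form `e(t)` on `G × I` obtained by pulling back `e t` under `G × I → G` at time `t`. -/
noncomputable def pullOneForm (e : ℝ → ∀ x : G, TangentSpace (𝓡 3) x →L[ℝ] ℝ) (p : G × I) :
    TangentSpace ((𝓡 3).prod 𝓘(ℝ, ℝ)) p →L[ℝ] ℝ :=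
  (e p.2 p.1).comp
    (mfderiv ((𝓡 3).prod 𝓘(ℝ, ℝ)) (𝓡 3) (Prod.fst : G × I → G) p)

/-- The 1-form `f(t) dt` on `G × I`. -/
noncomputable def timeForm (f : ℝ → ℝ) (p : G × I) :
    TangentSpace ((𝓡 3).prod 𝓘(ℝ, ℝ)) p →L[ℝ] ℝ :=
  f p.2 • mvfderiv ((𝓡 3).prod 𝓘(ℝ, ℝ)) (fun q : G × I ↦ (q.2 : ℝ)) p

/-- The three 2-forms on `G × I`:
`F₁ = e¹ ∧ e² + e³ ∧ f dt`, `F₂ = e¹ ∧ e³ - e² ∧ f dt`, `F₃ = e² ∧ e³ + e¹ ∧ f dt`. -/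
noncomputable def evolutionForms (e : Fin 3 → ℝ → ∀ x : G, TangentSpace (𝓡 3) x →L[ℝ] ℝ)
    (f : ℝ → ℝ) : Fin 3 → ∀ p : G × I, TangentSpace ((𝓡 3).prod 𝓘(ℝ, ℝ)) p [⋀^Fin 2]→L[ℝ] ℝ :=
  ![fun p ↦ wedge (pullOneForm (e 0) p) (pullOneForm (e 1) p)
      + wedge (pullOneForm (e 2) p) (timeForm f p),
    fun p ↦ wedge (pullOneForm (e 0) p) (pullOneForm (e 2) p)
      - wedge (pullOneForm (e 1) p) (timeForm f p),
    fun p ↦ wedge (pullOneForm (e 1) p) (pullOneForm (e 2) p)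
      + wedge (pullOneForm (e 0) p) (timeForm f p)]

end Evolution

/-! Everything is read off in one frame. The 1-forms `e¹, e², e³, f dt` form a global coframe on `G
× I`; declaring its dual frame `X` orthonormal and letting `J_s` act by the constant matrices
`hyperMatrix s` gives a structure with fundamental forms `F_s`. There is no other: `F₁(J₂ v, w) =
g(J₃ v, w) = F₃(v, w)` determines `J₂`, then `g = -F₂(J₂ ·, ·)` determines `g`, and then all `J_s`
are determined (`AlmostHyperHermitian.ext_fundamentalForm`).

In an orthonormal frame the Koszul formula expresses the Levi-Civita connection through the brackets
of the frame, and an endomorphism with constant matrix is parallel iff that matrix commutes with the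
connection matrices (`exists_isLeviCivita_isParallelEndo_iff`). A skew 4×4 matrix commutes with the
three `J_s` iff its components along them vanish (`commute_hyperMatrix_iff`), so there are three
linear equations for each of the four directions. By Cartan's formula the bracket coefficients are
`-dθ(X_a, X_b)`, where `d(f dt) = 0` and the differential of the pulled back `e^k` is `de^k + dt ∧
∂_t e^k`. Linear algebra (`structure_equations_iff`) regroups the twelve equations at a point into
the three equations `de^{ij} = 0` and the nine equations `∂_t e^{ij} = -f de^k`. Hence the structure
is hyper-Kähler iff both systems hold at every `(x, t)` (`koszulCoeff_commute_iff`).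

Closedness at a single time is enough, because the evolution equations preserve it: `∂_t de^{ij} =
d(∂_t e^{ij}) = -f d(de^k) = 0`, and `I` is connected (`mextDeriv_wedge_eq_zero_of_evolution`). -/

section
-- 1-forms and their exterior derivative in charts.
variable {E : Type*} [NormedAddCommGroup E] [NormedSpace ℝ E]
  {H : Type*} [TopologicalSpace H] {I : ModelWithCorners ℝ E H}
  {M : Type*} [TopologicalSpace M] [ChartedSpace H M] [IsManifold I 1 M]
  {E' : Type*} [NormedAddCommGroup E'] [NormedSpace ℝ E']
  {H' : Type*} [TopologicalSpace H'] {J : ModelWithCorners ℝ E' H'}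
  {N : Type*} [TopologicalSpace N] [ChartedSpace H' N] {n : ℕ∞ω}

lemma inCoordinates_trivial (x₀ x : M) (a : TangentSpace I x →L[ℝ] ℝ) :
    ContinuousLinearMap.inCoordinates E (TangentSpace I) ℝ (Trivial M ℝ) x₀ x x₀ x a =
      a.comp ((trivializationAt E (TangentSpace I) x₀).symmL ℝ x) := by
  ext v
  simp [ContinuousLinearMap.inCoordinates]

/-- Reduces bundle smoothness to smoothness of a map into the fixed space `E →L[ℝ] ℝ`. The base map
`b` is arbitrary because a time-dependent form on `G` is a section along the projection `G × I → G`.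
-/
lemma contMDiffAt_covector_iff {b : N → M} {a : ∀ q : N, TangentSpace I (b q) →L[ℝ] ℝ} {q₀ : N} :
    ContMDiffAt J (I.prod 𝓘(ℝ, E →L[ℝ] ℝ)) n
      (fun q ↦ TotalSpace.mk' (E →L[ℝ] ℝ)
        (E := fun x : M ↦ TangentSpace I x →L[ℝ] Trivial M ℝ x) (b q) (a q)) q₀ ↔
    ContMDiffAt J I n b q₀ ∧ ContMDiffAt J 𝓘(ℝ, E →L[ℝ] ℝ) n
      (fun q ↦ (a q).comp ((trivializationAt E (TangentSpace I) (b q₀)).symmL ℝ (b q))) q₀ := by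
  rw [contMDiffAt_hom_bundle]
  simp only [← inCoordinates_trivial]

/-- The coordinate expression of a 1-form in the preferred chart at `x₀`. -/
noncomputable def chartForm (I : ModelWithCorners ℝ E H) (x₀ : M)
    (α : ∀ x : M, TangentSpace I x →L[ℝ] ℝ) (y : E) : E →L[ℝ] ℝ :=
  (α ((extChartAt I x₀).symm y)).comp
    (mfderivWithin 𝓘(ℝ, E) I (extChartAt I x₀).symm (range I) y)

lemma chartForm_eq_symmL (α : ∀ x : M, TangentSpace I x →L[ℝ] ℝ) {x₀ : M} {y : E}
    (hy : y ∈ (extChartAt I x₀).target) :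
    chartForm I x₀ α y = (α ((extChartAt I x₀).symm y)).comp
      ((trivializationAt E (TangentSpace I) x₀).symmL ℝ ((extChartAt I x₀).symm y)) := by
  rw [TangentBundle.symmL_trivializationAt, (extChartAt I x₀).right_inv hy, chartForm]
  rw [← extChartAt_source I]
  exact (extChartAt I x₀).map_target hy

lemma chartForm_extChartAt_self (α : ∀ x : M, TangentSpace I x →L[ℝ] ℝ) (x₀ : M)
    (v : TangentSpace I x₀) : chartForm I x₀ α (extChartAt I x₀ x₀) v = α x₀ v := by
  -- The point obtained by going through the chart and back equals `x₀` only propositionally, so the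
  -- fibre is changed by generalizing the point.
  have h : ∀ y, y = x₀ → α y v = α x₀ v := by rintro y rfl; rfl
  exact (congrArg (α ((extChartAt I x₀).symm (extChartAt I x₀ x₀)))
    (DFunLike.congr_fun (mfderivWithin_range_extChartAt_symm (𝕜 := ℝ) (I := I) (x := x₀)) v)).trans
    (h _ (extChartAt_to_inv x₀))

lemma ContMDiffAt.contDiffAt_chartForm [I.Boundaryless] {α : ∀ x : M, TangentSpace I x →L[ℝ] ℝ}
    {x₀ : M} (hn : n ≤ ∞) [IsManifold I ∞ M]
    (h : ContMDiffAt I (I.prod 𝓘(ℝ, E →L[ℝ] ℝ)) n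
      (fun q ↦ TotalSpace.mk' (E →L[ℝ] ℝ)
        (E := fun x : M ↦ TangentSpace I x →L[ℝ] Trivial M ℝ x) q (α q)) x₀) :
    ContDiffAt ℝ n (chartForm I x₀ α) (extChartAt I x₀ x₀) := by
  have h1 := (contMDiffAt_covector_iff.1 h).2
  have h2 : ContMDiffAt 𝓘(ℝ, E) I n (extChartAt I x₀).symm (extChartAt I x₀ x₀) :=
    ((contMDiffOn_extChartAt_symm x₀).contMDiffAt (extChartAt_target_mem_nhds x₀)).of_le hn
  have h3 := ContMDiffAt.comp_of_eq h1 h2 (extChartAt_to_inv x₀)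
  rw [contMDiffAt_iff_contDiffAt] at h3
  refine h3.congr_of_eventuallyEq ?_
  filter_upwards [extChartAt_target_mem_nhds (I := I) x₀] with y hy
  rw [chartForm_eq_symmL _ hy]
  rfl

/-- The derivative of the chart at its own centre is the identity, and without boundary `range I` is
the whole space. -/
lemma mextDeriv_apply_eq_extDeriv [I.Boundaryless] {n : ℕ}
    (α : ∀ x : M, TangentSpace I x [⋀^Fin n]→L[ℝ] ℝ) (x₀ : M)
    (v : Fin (n + 1) → TangentSpace I x₀) :
    mextDeriv I α x₀ v = extDeriv (E := E)
      (fun y : E ↦ (α ((extChartAt I x₀).symm y)).compContinuousLinearMap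
        (mfderivWithin 𝓘(ℝ, E) I (extChartAt I x₀).symm (range I) y))
      (extChartAt I x₀ x₀) v := by
  rw [← extDerivWithin_univ, ← I.range_eq_univ]
  simp only [mextDeriv]
  rw [mfderiv_extChartAt_self]
  rfl

lemma extDeriv_toOneForm {a : E → E →L[ℝ] ℝ} {y : E} (ha : DifferentiableAt ℝ a y) (v : Fin 2 → E) :
    extDeriv (fun z ↦ toOneForm (a z)) y v = fderiv ℝ a y (v 0) (v 1) - fderiv ℝ a y (v 1) (v 0) := by
  let T : (E →L[ℝ] ℝ) →L[ℝ] (E [⋀^Fin 1]→L[ℝ] ℝ) :=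
    (ContinuousAlternatingMap.ofSubsingletonLIE (𝕜 := ℝ) (E := E) (F := ℝ) (0 : Fin 1)
      ).toContinuousLinearEquiv.toContinuousLinearMap
  have h : (fun z ↦ toOneForm (a z)) = T ∘ a := rfl
  have hT : ∀ (b : E →L[ℝ] ℝ) (w : Fin 1 → E), T b w = b (w 0) := fun b w ↦ rfl
  have hd : DifferentiableAt ℝ (T ∘ a) y := T.differentiableAt.comp _ ha
  rw [h, extDeriv_apply hd]
  have h2 : ∀ (w : Fin 1 → E) (u : E), fderiv ℝ (fun z ↦ (T ∘ a) z w) y u = fderiv ℝ a y u (w 0) := by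
    intro w u
    simp only [Function.comp, hT]
    rw [fderiv_clm_apply ha (differentiableAt_const _)]
    simp
  simp only [h2]
  simp [Fin.removeNth]
  ring

lemma mextDeriv_toOneForm [I.Boundaryless] {α : ∀ x : M, TangentSpace I x →L[ℝ] ℝ} {x₀ : M}
    (h : DifferentiableAt ℝ (chartForm I x₀ α) (extChartAt I x₀ x₀))
    (u v : TangentSpace I x₀) :
    mextDeriv I (fun x ↦ toOneForm (α x)) x₀ ![u, v] =
      fderiv ℝ (chartForm I x₀ α) (extChartAt I x₀ x₀) u v -
      fderiv ℝ (chartForm I x₀ α) (extChartAt I x₀ x₀) v u := by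
  rw [mextDeriv_apply_eq_extDeriv]
  exact extDeriv_toOneForm h ![u, v]

end

/-! ### Vector fields in charts and Cartan's formula. -/

section
variable {E : Type*} [NormedAddCommGroup E] [NormedSpace ℝ E]
  {H : Type*} [TopologicalSpace H] {I : ModelWithCorners ℝ E H}
  {M : Type*} [TopologicalSpace M] [ChartedSpace H M]

/-- A smooth 1-form on a manifold. -/
abbrev SmoothOneForm (I : ModelWithCorners ℝ E H) [IsManifold I 1 M]
    (α : ∀ x : M, TangentSpace I x →L[ℝ] ℝ) : Prop :=
  ContMDiff I (I.prod 𝓘(ℝ, E →L[ℝ] ℝ)) ∞ (fun x ↦ TotalSpace.mk' (E →L[ℝ] ℝ)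
    (E := fun x : M ↦ TangentSpace I x →L[ℝ] Trivial M ℝ x) x (α x))

lemma SmoothOneForm.differentiableAt_chartForm [IsManifold I ∞ M] [I.Boundaryless]
    {α : ∀ x : M, TangentSpace I x →L[ℝ] ℝ}
    (hα : SmoothOneForm I α) (x₀ : M) :
    DifferentiableAt ℝ (chartForm I x₀ α) (extChartAt I x₀ x₀) :=
  ((hα x₀).contDiffAt_chartForm le_rfl).differentiableAt (by simp)

lemma SmoothOneForm.mdifferentiableAt_apply [IsManifold I 1 M]
    {α : ∀ x : M, TangentSpace I x →L[ℝ] ℝ} (hα : SmoothOneForm I α) {X : ∀ x : M, TangentSpace I x}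
    {x₀ : M} (hX : MDiffAt (T% X) x₀) :
    MDifferentiableAt I 𝓘(ℝ, ℝ) (fun x ↦ α x (X x)) x₀ := by
  have h := MDifferentiableAt.clm_bundle_apply ((hα x₀).mdifferentiableAt (by simp)) hX
  rw [mdifferentiableAt_totalSpace] at h
  simpa using h.2

/-- The coordinate expression of a vector field in the preferred chart at `x₀`. -/
noncomputable def chartField (I : ModelWithCorners ℝ E H) (x₀ : M)
    (X : ∀ x : M, TangentSpace I x) (y : E) : E :=
  VectorField.mpullbackWithin 𝓘(ℝ, E) I (extChartAt I x₀).symm X (range I) y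

lemma chartField_extChartAt_self [IsManifold I 1 M] (X : ∀ x : M, TangentSpace I x) (x₀ : M) :
    chartField I x₀ X (extChartAt I x₀ x₀) = X x₀ := by
  have h : ∀ y, y = x₀ → (X y : E) = X x₀ := by rintro y rfl; rfl
  exact (mfderivWithin_extChartAt_symm_inverse_apply (I := I) (x := x₀)
    (X ((extChartAt I x₀).symm (extChartAt I x₀ x₀)))).trans (h _ (extChartAt_to_inv x₀))

lemma chartForm_chartField [IsManifold I 1 M] (α : ∀ x : M, TangentSpace I x →L[ℝ] ℝ)
    (X : ∀ x : M, TangentSpace I x) {x₀ : M} {y : E} (hy : y ∈ (extChartAt I x₀).target) :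
    chartForm I x₀ α y (chartField I x₀ X y) =
      α ((extChartAt I x₀).symm y) (X ((extChartAt I x₀).symm y)) :=
  congrArg (α ((extChartAt I x₀).symm y))
    ((isInvertible_mfderivWithin_extChartAt_symm hy).self_apply_inverse _)

lemma differentiableAt_chartField [I.Boundaryless] [CompleteSpace E]
    [IsManifold I ∞ M] {X : ∀ x : M, TangentSpace I x} {x₀ : M} (hX : MDiffAt (T% X) x₀) :
    DifferentiableAt ℝ (chartField I x₀ X) (extChartAt I x₀ x₀) := by
  have : IsManifold I 2 M := inferInstance
  have h := MDifferentiableWithinAt.differentiableWithinAt_mpullbackWithin_vectorField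
    (mdifferentiableWithinAt_univ.2 hX)
  rw [preimage_univ, univ_inter] at h
  have h' : DifferentiableWithinAt ℝ (chartField I x₀ X) (range I) (extChartAt I x₀ x₀) := h
  rwa [I.range_eq_univ, differentiableWithinAt_univ] at h'

/-- The Leibniz rule for the pairing, carried out in the chart at `x₀`, at whose centre coordinate
expressions agree with the intrinsic objects. -/
lemma SmoothOneForm.mvfderiv_apply [IsManifold I ∞ M] [I.Boundaryless] [CompleteSpace E]
    {α : ∀ x : M, TangentSpace I x →L[ℝ] ℝ} (hα : SmoothOneForm I α) {X : ∀ x : M, TangentSpace I x}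
    {x₀ : M} (hX : MDiffAt (T% X) x₀) (v : TangentSpace I x₀) :
    mvfderiv I (fun x ↦ α x (X x)) x₀ v =
      fderiv ℝ (chartForm I x₀ α) (extChartAt I x₀ x₀) v (X x₀) +
        α x₀ (fderiv ℝ (chartField I x₀ X) (extChartAt I x₀ x₀) v) := by
  have h := hα.mdifferentiableAt_apply hX
  have e1 : mvfderiv I (fun x ↦ α x (X x)) x₀ v =
      fderiv ℝ (fun y ↦ chartForm I x₀ α y (chartField I x₀ X y)) (extChartAt I x₀ x₀) v := by
    have : mfderiv I 𝓘(ℝ, ℝ) (fun x ↦ α x (X x)) x₀ v =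
        fderiv ℝ (writtenInExtChartAt I 𝓘(ℝ, ℝ) x₀ (fun x ↦ α x (X x))) (extChartAt I x₀ x₀) v := by
      rw [h.mfderiv, I.range_eq_univ, fderivWithin_univ]
      rfl
    refine this.trans ?_
    congr 1
    apply Filter.EventuallyEq.fderiv_eq
    filter_upwards [extChartAt_target_mem_nhds (I := I) x₀] with y hy
    rw [chartForm_chartField α X hy]
    rfl
  rw [e1, fderiv_clm_apply (hα.differentiableAt_chartForm x₀) (differentiableAt_chartField hX),
    chartField_extChartAt_self]
  exact (add_comm _ _).trans (congrArg (_ + ·) (chartForm_extChartAt_self α x₀ _))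

lemma mlieBracket_eq_lieBracket_chartField [IsManifold I 1 M] [I.Boundaryless]
    (X Y : ∀ x : M, TangentSpace I x) (x₀ : M) :
    VectorField.mlieBracket I X Y x₀ =
      VectorField.lieBracket ℝ (chartField I x₀ X) (chartField I x₀ Y) (extChartAt I x₀ x₀) := by
  have h1 : (mfderiv I 𝓘(ℝ, E) (extChartAt I x₀) x₀).inverse = ContinuousLinearMap.id ℝ E :=
    (congrArg (ContinuousLinearMap.inverse (M := E) (M₂ := E))
      (mfderiv_extChartAt_self (𝕜 := ℝ) (I := I) (x := x₀))).trans ContinuousLinearMap.inverse_id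
  refine (DFunLike.congr_fun h1 _).trans ?_
  rw [preimage_univ, univ_inter]
  change VectorField.lieBracketWithin ℝ (chartField I x₀ X) (chartField I x₀ Y) (range I) _ = _
  rw [I.range_eq_univ, VectorField.lieBracketWithin_univ]

/-- Cartan's formula `α([X, Y]) = X(α(Y)) - Y(α(X)) - dα(X, Y)`, from two Leibniz expansions. For a
frame and its dual coframe the pairings are constant, so the brackets are read off from `dα` alone.
-/
lemma SmoothOneForm.apply_mlieBracket [IsManifold I ∞ M] [I.Boundaryless] [CompleteSpace E]
    {α : ∀ x : M, TangentSpace I x →L[ℝ] ℝ} (hα : SmoothOneForm I α)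
    {X Y : ∀ x : M, TangentSpace I x} {x₀ : M} (hX : MDiffAt (T% X) x₀) (hY : MDiffAt (T% Y) x₀) :
    α x₀ (VectorField.mlieBracket I X Y x₀) =
      mvfderiv I (fun x ↦ α x (Y x)) x₀ (X x₀) - mvfderiv I (fun x ↦ α x (X x)) x₀ (Y x₀) -
        (fderiv ℝ (chartForm I x₀ α) (extChartAt I x₀ x₀) (X x₀) (Y x₀) -
          fderiv ℝ (chartForm I x₀ α) (extChartAt I x₀ x₀) (Y x₀) (X x₀)) := by
  rw [mlieBracket_eq_lieBracket_chartField, hα.mvfderiv_apply hX, hα.mvfderiv_apply hY,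
    VectorField.lieBracket, chartField_extChartAt_self, chartField_extChartAt_self]
  have := map_sub (α x₀) (fderiv ℝ (chartField I x₀ Y) (extChartAt I x₀ x₀) (X x₀))
    (fderiv ℝ (chartField I x₀ X) (extChartAt I x₀ x₀) (Y x₀))
  have key : ∀ a b c d : ℝ, a - b = (c + a) - (d + b) - (c - d) := by intros; ring
  exact this.trans (key _ _ _ _)
end

/-! ### Dual frames and tensors built from a coframe. -/

section
variable {E : Type*} [NormedAddCommGroup E] [NormedSpace ℝ E]
  {H : Type*} [TopologicalSpace H] {I : ModelWithCorners ℝ E H}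
  {M : Type*} [TopologicalSpace M] [ChartedSpace H M] [IsManifold I 1 M]

/-- A smooth global frame `X` of the tangent bundle together with its smooth dual coframe `θ`. -/
structure IsSmoothFrame {ι : Type*} [Fintype ι] [DecidableEq ι] (θ : ι → ∀ x : M, TangentSpace I x →L[ℝ] ℝ)
    (X : ι → ∀ x : M, TangentSpace I x) : Prop where
  smooth_coframe : ∀ i, SmoothOneForm I (θ i)
  smooth_frame : ∀ i, ContMDiff I I.tangent ∞ (T% (X i))
  apply_frame : ∀ i j x, θ i x (X j x) = if i = j then 1 else 0
  sum_smul : ∀ x v, ∑ i, θ i x v • X i x = v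

lemma contMDiffAt_inverse_apply {ι : Type*} [Fintype ι] [CompleteSpace E] {N : Type*}
    {E' : Type*} [NormedAddCommGroup E'] [NormedSpace ℝ E'] {H' : Type*} [TopologicalSpace H']
    {J : ModelWithCorners ℝ E' H'} [TopologicalSpace N] [ChartedSpace H' N]
    {L : N → E →L[ℝ] (ι → ℝ)} {q₀ : N} (hL : ContMDiffAt J 𝓘(ℝ, E →L[ℝ] (ι → ℝ)) ∞ L q₀)
    (hinv : (L q₀).IsInvertible) (w : ι → ℝ) :
    ContMDiffAt J 𝓘(ℝ, E) ∞ (fun q ↦ (L q).inverse w) q₀ := by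
  have h1 : ContDiffAt ℝ ∞ ContinuousLinearMap.inverse (L q₀) :=
    hinv.contDiffAt_map_inverse
  have h2 := h1.contMDiffAt.comp q₀ hL
  exact h2.clm_apply contMDiffAt_const

/-- Independent functionals in the number of the dimension span the dual space, so their common
kernel is trivial. -/
lemma isInvertible_pi_of_linearIndependent {ι : Type*} [Fintype ι] [FiniteDimensional ℝ E]
    (hcard : Fintype.card ι = Module.finrank ℝ E) {θ : ι → E →L[ℝ] ℝ} (hli : LinearIndependent ℝ θ) :
    (ContinuousLinearMap.pi θ : E →L[ℝ] (ι → ℝ)).IsInvertible := by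
  have hli' : LinearIndependent ℝ (fun i ↦ (θ i : Module.Dual ℝ E)) :=
    hli.map' (ContinuousLinearMap.coeLM ℝ) (LinearMap.ker_eq_bot.2 ContinuousLinearMap.coe_injective)
  have hspan : Submodule.span ℝ (range fun i ↦ (θ i : Module.Dual ℝ E)) = ⊤ :=
    hli'.span_eq_top_of_card_eq_finrank' (by rw [hcard, Subspace.dual_finrank_eq])
  have hinj : Function.Injective (ContinuousLinearMap.pi θ : E →ₗ[ℝ] (ι → ℝ)) := by
    rw [injective_iff_map_eq_zero]
    intro v hv
    have h0 : ∀ φ : Module.Dual ℝ E, φ v = 0 := by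
      intro φ
      have hφ : φ ∈ Submodule.span ℝ (range fun i ↦ (θ i : Module.Dual ℝ E)) := hspan ▸ trivial
      induction hφ using Submodule.span_induction with
      | mem x h =>
        obtain ⟨i, rfl⟩ := h
        exact congrFun hv i
      | zero => rfl
      | add x y _ _ hx hy => simp [hx, hy]
      | smul a x _ hx => simp [hx]
    exact (Module.forall_dual_apply_eq_zero_iff ℝ v).1 h0
  refine ⟨(LinearEquiv.ofInjectiveOfFinrankEq _ hinj (by simp [hcard])).toContinuousLinearEquiv, ?_⟩
  ext v
  rfl

/-- A smooth coframe has a smooth dual frame. -/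
lemma exists_isSmoothFrame {ι : Type*} [Fintype ι] [DecidableEq ι] [FiniteDimensional ℝ E]
    (hcard : Fintype.card ι = Module.finrank ℝ E)
    (θ : ι → ∀ x : M, TangentSpace I x →L[ℝ] ℝ) (hθ : ∀ i, SmoothOneForm I (θ i))
    (hli : ∀ x, LinearIndependent ℝ (fun i ↦ θ i x)) :
    ∃ X : ι → ∀ x : M, TangentSpace I x, IsSmoothFrame θ X := by
  have hinv : ∀ x : M, (ContinuousLinearMap.pi fun i ↦ θ i x :
      TangentSpace I x →L[ℝ] (ι → ℝ)).IsInvertible :=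
    fun x ↦ isInvertible_pi_of_linearIndependent (E := E) hcard (hli x)
  have happ : ∀ i j x, θ i x ((ContinuousLinearMap.pi fun i ↦ θ i x).inverse (Pi.single j 1)) =
      if i = j then 1 else 0 := by
    intro i j x
    have := congrFun ((hinv x).self_apply_inverse (Pi.single j 1)) i
    simpa [Pi.single_apply] using! this
  -- The dual frame is the preimage of the standard basis under `v ↦ (θ i x v)_i`; its smoothness
  -- comes from that of operator inversion.
  refine ⟨fun i x ↦ (ContinuousLinearMap.pi fun i ↦ θ i x).inverse (Pi.single i 1), hθ, ?_, happ, ?_⟩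
  · intro j x₀
    rw [contMDiffAt_totalSpace]
    refine ⟨contMDiffAt_id, ?_⟩
    let t := trivializationAt E (TangentSpace I) x₀
    -- Composing with the trivialization at `x₀` gives operators on the fixed space `E`, to which
    -- `contMDiffAt_inverse_apply` applies.
    let L : M → E →L[ℝ] (ι → ℝ) := fun x ↦
      ContinuousLinearMap.pi fun i ↦ (θ i x).comp (t.symmL ℝ x)
    have hL : ContMDiffAt I 𝓘(ℝ, E →L[ℝ] (ι → ℝ)) ∞ L x₀ := by
      let P := (ContinuousLinearMap.piEquivL ℝ E (fun _ : ι ↦ ℝ))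
      have h1 : ContMDiffAt I 𝓘(ℝ, ι → (E →L[ℝ] ℝ)) ∞ (fun x i ↦ (θ i x).comp (t.symmL ℝ x)) x₀ :=
        contMDiffAt_pi_space.2 fun i ↦ (contMDiffAt_covector_iff.1 (hθ i x₀)).2
      exact P.contDiff.contMDiff.contMDiffAt.comp x₀ h1
    have hLinv : ∀ x ∈ t.baseSet, (L x).IsInvertible := by
      intro x hx
      have h1 : (t.symmL ℝ x).IsInvertible := ⟨(t.continuousLinearEquivAt ℝ x hx).symm, by
        ext v
        exact congrFun (t.symm_continuousLinearEquivAt_eq hx) v⟩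
      exact (hinv x).comp h1
    refine (contMDiffAt_inverse_apply hL (hLinv x₀ (mem_baseSet_trivializationAt E _ x₀))
      (Pi.single j 1)).congr_of_eventuallyEq ?_
    filter_upwards [t.open_baseSet.mem_nhds (mem_baseSet_trivializationAt E _ x₀)] with x hx
    symm
    rw [(hLinv x hx).inverse_apply_eq]
    ext i
    change _ = θ i x (t.symmL ℝ x (t ⟨x, _⟩).2)
    have : t.symmL ℝ x (t ⟨x, (ContinuousLinearMap.pi fun i ↦ θ i x).inverse (Pi.single j 1)⟩).2 =
      (ContinuousLinearMap.pi fun i ↦ θ i x).inverse (Pi.single j 1) := by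
      rw [← t.continuousLinearMapAt_apply_of_mem ℝ hx]
      exact t.symmL_continuousLinearMapAt hx _
    rw [this, happ]
    simp [Pi.single_apply]
  · intro x v
    refine (hinv x).injective ?_
    ext i
    simp [happ]

/-- Tensor products `α ⊗ s` are the building blocks of the metric (`V` the cotangent bundle) and of
the fields `endo` (`V` the tangent bundle). -/
lemma SmoothOneForm.smulRight {F : Type*} [NormedAddCommGroup F] [NormedSpace ℝ F]
    {V : M → Type*} [TopologicalSpace (TotalSpace F V)]
    [∀ x, AddCommGroup (V x)] [∀ x, Module ℝ (V x)] [∀ x, TopologicalSpace (V x)]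
    [∀ x, IsTopologicalAddGroup (V x)] [∀ x, ContinuousSMul ℝ (V x)]
    [FiberBundle F V] [VectorBundle ℝ F V]
    {α : ∀ x : M, TangentSpace I x →L[ℝ] ℝ} (hα : SmoothOneForm I α)
    {s : ∀ x : M, V x} (hs : ContMDiff I (I.prod 𝓘(ℝ, F)) ∞ (fun x ↦ TotalSpace.mk' F x (s x))) :
    ContMDiff I (I.prod 𝓘(ℝ, E →L[ℝ] F)) ∞ (fun x ↦ TotalSpace.mk' (E →L[ℝ] F)
      (E := fun x : M ↦ TangentSpace I x →L[ℝ] V x) x ((α x).smulRight (s x))) := by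
  intro x₀
  rw [contMDiffAt_hom_bundle]
  refine ⟨contMDiffAt_id, ?_⟩
  have h1 := (contMDiffAt_covector_iff.1 (hα x₀)).2
  have h2 := (contMDiffAt_totalSpace.1 (hs x₀)).2
  have h0 : ContDiff ℝ ∞ (fun p : (E →L[ℝ] ℝ) × F ↦ p.1.smulRight p.2) :=
    contDiff_fst.smulRight contDiff_snd
  have h3 := h0.contMDiff.contMDiffAt.comp x₀ (h1.prodMk_space h2)
  refine h3.congr_of_eventuallyEq ?_
  have hb := (trivializationAt F V x₀).open_baseSet.mem_nhds (mem_baseSet_trivializationAt F V x₀)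
  filter_upwards [hb] with x hx
  ext v
  simp only [ContinuousLinearMap.inCoordinates, ContinuousLinearMap.comp_apply,
    ContinuousLinearMap.smulRight_apply, Function.comp]
  rw [map_smul, (trivializationAt F V x₀).continuousLinearMapAt_apply_of_mem ℝ hx]

end

/-! ### The Levi-Civita connection in an orthonormal frame. -/

section
variable {E : Type*} [NormedAddCommGroup E] [NormedSpace ℝ E]
  {H : Type*} [TopologicalSpace H] {I : ModelWithCorners ℝ E H}
  {M : Type*} [TopologicalSpace M] [ChartedSpace H M]

lemma mvfderiv_fun_sum {ι : Type*} (s : Finset ι) {f : ι → M → ℝ} {x : M}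
    (hf : ∀ i ∈ s, MDifferentiableAt I 𝓘(ℝ, ℝ) (f i) x) :
    mvfderiv I (fun y ↦ ∑ i ∈ s, f i y) x = ∑ i ∈ s, mvfderiv I (f i) x := by
  classical
  have : MDifferentiableAt I 𝓘(ℝ, ℝ) (fun y ↦ ∑ i ∈ s, f i y) x ∧
      mvfderiv I (fun y ↦ ∑ i ∈ s, f i y) x = ∑ i ∈ s, mvfderiv I (f i) x := by
    induction s using Finset.induction_on with
    | empty => exact ⟨by simpa using mdifferentiableAt_const, by simpa using mvfderiv_const 0⟩
    | insert i s hi ih =>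
      have h1 := ih fun j hj ↦ hf j (Finset.mem_insert_of_mem hj)
      have h2 := hf i (Finset.mem_insert_self i s)
      simp only [Finset.sum_insert hi]
      exact ⟨h2.add h1.1, by rw [mvfderiv_fun_add h2 h1.1, h1.2]⟩
  exact this.2

variable [IsManifold I ∞ M] {ι : Type*} [Fintype ι] [DecidableEq ι]
  {θ : ι → ∀ x : M, TangentSpace I x →L[ℝ] ℝ} {X : ι → ∀ x : M, TangentSpace I x}

namespace IsSmoothFrame

variable (h : IsSmoothFrame θ X)
include h

lemma ext_of_coframe {x : M} {v w : TangentSpace I x} (hvw : ∀ i, θ i x v = θ i x w) : v = w := by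
  rw [← h.sum_smul x v, ← h.sum_smul x w]
  simp only [hvw]

lemma mdifferentiableAt_frame (i : ι) (x : M) : MDiffAt (T% (X i)) x :=
  (h.smooth_frame i x).mdifferentiableAt (by simp)

/-- The Riemannian metric for which the frame is orthonormal. -/
noncomputable def metric : ContMDiffRiemannianMetric I ∞ E (fun x : M ↦ TangentSpace I x) where
  inner x := ∑ i, (θ i x).smulRight (θ i x)
  symm x v w := by
    simp only [_root_.sum_apply, ContinuousLinearMap.smulRight_apply, smul_eq_mul,
      _root_.smul_apply, mul_comm]
  pos x v hv := by
    simp only [_root_.sum_apply, ContinuousLinearMap.smulRight_apply, smul_eq_mul,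
      _root_.smul_apply]
    refine lt_of_le_of_ne (Finset.sum_nonneg fun i _ ↦ mul_self_nonneg _) fun h0 ↦ hv ?_
    refine h.ext_of_coframe fun i ↦ ?_
    have := (Finset.sum_eq_zero_iff_of_nonneg (fun i _ ↦ mul_self_nonneg _)).1 h0.symm i
      (Finset.mem_univ i)
    simpa using this
  isVonNBounded x := by
    -- `L` rebuilds a vector from its coefficients. A vector of metric length at most 1 has all
    -- coefficients in `[-1, 1]`, so the metric ball lies in the image under `L` of a bounded set.
    let L : (ι → ℝ) →L[ℝ] TangentSpace I x :=
      ∑ i, (ContinuousLinearMap.proj (R := ℝ) (φ := fun _ : ι ↦ ℝ) i).smulRight (X i x)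
    refine ((NormedSpace.isVonNBounded_closedBall ℝ (ι → ℝ) 1).image L).subset ?_
    intro v hv
    simp only [mem_ofPred_eq, _root_.sum_apply, ContinuousLinearMap.smulRight_apply, smul_eq_mul,
      _root_.smul_apply] at hv
    refine ⟨fun i ↦ θ i x v, ?_, by simpa [L] using h.sum_smul x v⟩
    rw [mem_closedBall_zero_iff, pi_norm_le_iff_of_nonneg zero_le_one]
    intro i
    have := Finset.single_le_sum (f := fun i ↦ θ i x v * θ i x v)
      (fun i _ ↦ mul_self_nonneg _) (Finset.mem_univ i)
    rw [Real.norm_eq_abs, ← sq_le_one_iff_abs_le_one, sq]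
    linarith
  contMDiff := by
    have h1 := fun i ↦ (h.smooth_coframe i).smulRight (h.smooth_coframe i)
    exact ContMDiff.sum_section fun i _ ↦ h1 i

lemma metric_inner (x : M) (v w : TangentSpace I x) :
    h.metric.inner x v w = ∑ i, θ i x v * θ i x w := by
  simp [metric]

omit h in
/-- The field of endomorphisms with matrix `T` in the frame `X`. -/
noncomputable def endo (θ : ι → ∀ x : M, TangentSpace I x →L[ℝ] ℝ) (X : ι → ∀ x : M, TangentSpace I x)
    (T : Matrix ι ι ℝ) (x : M) : TangentSpace I x →L[ℝ] TangentSpace I x :=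
  ∑ a, ∑ b, T a b • (θ b x).smulRight (X a x)

lemma apply_endo (T : Matrix ι ι ℝ) (x : M) (v : TangentSpace I x) (a : ι) :
    θ a x (endo θ X T x v) = ∑ b, T a b * θ b x v := by
  simp [endo, h.apply_frame]

lemma contMDiff_endo (T : Matrix ι ι ℝ) :
    ContMDiff I (I.prod 𝓘(ℝ, E →L[ℝ] E)) ∞ (fun x : M ↦ TotalSpace.mk' (E →L[ℝ] E)
      (E := fun x : M ↦ TangentSpace I x →L[ℝ] TangentSpace I x) x (endo θ X T x)) := by
  refine ContMDiff.sum_section fun a _ ↦ ContMDiff.sum_section fun b _ ↦ ?_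
  exact ContMDiff.const_smul_section ((h.smooth_coframe b).smulRight (h.smooth_frame a))

omit h in
/-- The coefficients `θ c [X a, X b]` of the Lie brackets of the frame. -/
noncomputable def bracketCoeff (θ : ι → ∀ x : M, TangentSpace I x →L[ℝ] ℝ)
    (X : ι → ∀ x : M, TangentSpace I x) (a b c : ι) (x : M) : ℝ :=
  θ c x (VectorField.mlieBracket I (X a) (X b) x)

omit h in
/-- The coefficients `θ c (∇_{X a} X b)` of the Levi-Civita connection, by the Koszul formula. -/
noncomputable def koszulCoeff (θ : ι → ∀ x : M, TangentSpace I x →L[ℝ] ℝ)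
    (X : ι → ∀ x : M, TangentSpace I x) (a b c : ι) (x : M) : ℝ :=
  (bracketCoeff θ X a b c x - bracketCoeff θ X b c a x + bracketCoeff θ X c a b x) / 2

omit h in
omit [IsManifold I ∞ M] [Fintype ι] [DecidableEq ι] in
lemma bracketCoeff_swap (a b c : ι) (x : M) :
    bracketCoeff θ X b a c x = - bracketCoeff θ X a b c x := by
  rw [bracketCoeff, VectorField.mlieBracket_swap_apply, map_neg, bracketCoeff]

omit h in
/-- The covariant derivative with coefficients `koszulCoeff`, as a function. -/
noncomputable def connectionFun (θ : ι → ∀ x : M, TangentSpace I x →L[ℝ] ℝ)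
    (X : ι → ∀ x : M, TangentSpace I x) (Y : ∀ x : M, TangentSpace I x) (x : M) :
    TangentSpace I x →L[ℝ] TangentSpace I x :=
  ∑ c, (mvfderiv I (fun y ↦ θ c y (Y y)) x +
    ∑ a, ∑ b, (koszulCoeff θ X a b c x * θ b x (Y x)) • θ a x).smulRight (X c x)

lemma apply_connectionFun (Y : ∀ x : M, TangentSpace I x) (x : M) (v : TangentSpace I x) (c : ι) :
    θ c x (connectionFun θ X Y x v) = mvfderiv I (fun y ↦ θ c y (Y y)) x v +
      ∑ a, ∑ b, koszulCoeff θ X a b c x * θ b x (Y x) * θ a x v := by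
  simp [connectionFun, h.apply_frame]

/-- The Levi-Civita connection of the metric for which the frame is orthonormal. -/
noncomputable def connection : CovariantDerivative I E (fun x : M ↦ TangentSpace I x) where
  toFun := connectionFun θ X
  isCovariantDerivativeOnUniv :=
    { add := by
        intro Y Z x hY hZ _
        ext v
        refine h.ext_of_coframe fun c ↦ ?_
        have key : mvfderiv I (fun y ↦ θ c y ((Y + Z) y)) x =
            mvfderiv I (fun y ↦ θ c y (Y y)) x + mvfderiv I (fun y ↦ θ c y (Z y)) x := by
          rw [← mvfderiv_fun_add ((h.smooth_coframe c).mdifferentiableAt_apply hY)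
            ((h.smooth_coframe c).mdifferentiableAt_apply hZ)]
          simp
        rw [h.apply_connectionFun, key]
        simp only [_root_.add_apply, map_add, h.apply_connectionFun]
        simp only [Pi.add_apply, map_add, mul_add, add_mul, Finset.sum_add_distrib]
        ring
      leibniz := by
        intro Y g x hY hg _
        ext v
        refine h.ext_of_coframe fun c ↦ ?_
        have key : mvfderiv I (fun y ↦ θ c y ((g • Y) y)) x =
            g x • mvfderiv I (fun y ↦ θ c y (Y y)) x + θ c x (Y x) • mvfderiv I g x := by
          rw [← mvfderiv_mul hg ((h.smooth_coframe c).mdifferentiableAt_apply hY)]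
          congr 1
          ext y
          simp
        rw [h.apply_connectionFun, key]
        simp only [_root_.add_apply, map_add, _root_.smul_apply, map_smul, h.apply_connectionFun]
        simp only [Pi.smul_apply', map_smul, smul_eq_mul,
          ContinuousLinearMap.smulRight_apply, mul_add, Finset.mul_sum]
        rw [add_right_comm, mul_comm (θ c x (Y x))]
        congr 1
        congr 1
        refine Finset.sum_congr rfl fun a _ ↦ Finset.sum_congr rfl fun b _ ↦ ?_
        ring }

lemma apply_connection (Y : ∀ x : M, TangentSpace I x) (x : M) (v : TangentSpace I x) (c : ι) :
    θ c x (h.connection Y x v) = mvfderiv I (fun y ↦ θ c y (Y y)) x v +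
      ∑ a, ∑ b, koszulCoeff θ X a b c x * θ b x (Y x) * θ a x v :=
  h.apply_connectionFun Y x v c

lemma apply_connection_frame (x : M) (a b c : ι) :
    θ c x (h.connection (X b) x (X a x)) = koszulCoeff θ X a b c x := by
  rw [h.apply_connection]
  simp [h.apply_frame, mvfderiv_const]

omit h in
omit [IsManifold I ∞ M] [Fintype ι] [DecidableEq ι] in
-- This skewness is compatibility with the metric, expressed in an orthonormal frame.
lemma koszulCoeff_skew (a b c : ι) (x : M) :
    koszulCoeff θ X a c b x = - koszulCoeff θ X a b c x := by
  simp only [koszulCoeff]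
  rw [bracketCoeff_swap b c, bracketCoeff_swap a b c, bracketCoeff_swap a c b]
  ring

omit h in
omit [IsManifold I ∞ M] [Fintype ι] [DecidableEq ι] in
-- This identity is the vanishing of the torsion on pairs of frame fields.
lemma koszulCoeff_sub_swap (a b c : ι) (x : M) :
    koszulCoeff θ X a b c x - koszulCoeff θ X b a c x = bracketCoeff θ X a b c x := by
  simp only [koszulCoeff]
  rw [bracketCoeff_swap b a c, bracketCoeff_swap b c a, bracketCoeff_swap a c b]
  ring

/-- Torsion is tensorial, so it is enough to test it on the frame. For the metric, the derivative
terms are the Leibniz rule for `∑ θ i(Y) θ i(Z)`, and the coefficient terms cancel by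
`koszulCoeff_skew`. -/
lemma isLeviCivita_connection [FiniteDimensional ℝ E] : IsLeviCivita I h.metric h.connection := by
  have : IsManifold I 2 M := inferInstance
  refine ⟨?_, ?_⟩
  · have key : ∀ x a b, h.connection.torsion x (X a x) (X b x) = 0 := by
      intro x a b
      rw [h.connection.torsion_apply (h.mdifferentiableAt_frame a x) (h.mdifferentiableAt_frame b x)]
      refine h.ext_of_coframe fun c ↦ ?_
      rw [map_sub, map_sub, h.apply_connection_frame, h.apply_connection_frame,
        koszulCoeff_sub_swap, map_zero, bracketCoeff, sub_self]
    ext x v w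
    rw [← h.sum_smul x v, ← h.sum_smul x w]
    simp only [map_sum, map_smul, _root_.sum_apply, _root_.smul_apply, key]
    simp
  · intro x Y Z hY hZ v
    have hd : ∀ i, mvfderiv I (fun y ↦ θ i y (Y y) * θ i y (Z y)) x v =
        θ i x (Y x) * mvfderiv I (fun y ↦ θ i y (Z y)) x v +
        θ i x (Z x) * mvfderiv I (fun y ↦ θ i y (Y y)) x v := by
      intro i
      have := mvfderiv_fun_mul ((h.smooth_coframe i).mdifferentiableAt_apply hY)
        ((h.smooth_coframe i).mdifferentiableAt_apply hZ)
      rw [this]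
      rfl
    simp only [h.metric_inner]
    rw [mvfderiv_fun_sum (f := fun i y ↦ θ i y (Y y) * θ i y (Z y)) _
      fun i _ ↦ ((h.smooth_coframe i).mdifferentiableAt_apply hY).mul
      ((h.smooth_coframe i).mdifferentiableAt_apply hZ), _root_.sum_apply]
    simp only [hd, h.apply_connection, add_mul, mul_add, Finset.sum_add_distrib]
    -- Exchanging the names of `b` and `c` in one of the sums turns the two into opposites, by
    -- skewness.
    have hz : (∑ c, (∑ a, ∑ b, koszulCoeff θ X a b c x * θ b x (Y x) * θ a x v) * θ c x (Z x)) +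
        ∑ c, θ c x (Y x) * (∑ a, ∑ b, koszulCoeff θ X a b c x * θ b x (Z x) * θ a x v) = 0 := by
      simp only [Finset.sum_mul, Finset.mul_sum]
      rw [Finset.sum_comm, Finset.sum_comm (s := Finset.univ (α := ι)) (t := Finset.univ (α := ι))
        (f := fun c a ↦ ∑ b, θ c x (Y x) * (koszulCoeff θ X a b c x * θ b x (Z x) * θ a x v)),
        ← Finset.sum_add_distrib]
      refine Finset.sum_eq_zero fun a _ ↦ ?_
      rw [Finset.sum_comm, ← Finset.sum_add_distrib]
      refine Finset.sum_eq_zero fun b _ ↦ ?_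
      rw [← Finset.sum_add_distrib]
      refine Finset.sum_eq_zero fun c _ ↦ ?_
      rw [koszulCoeff_skew a b c]
      ring
    have hc : ∀ i, mvfderiv I (fun y ↦ θ i y (Y y)) x v * θ i x (Z x) =
      θ i x (Z x) * mvfderiv I (fun y ↦ θ i y (Y y)) x v := fun i ↦ mul_comm _ _
    simp only [hc]
    linarith

/-- The uniqueness half of the Koszul argument: the inner products of frame fields are constant, so
the coefficients are skew in `b, c`; three such relations and three torsion relations, cyclic in `a,
b, c`, determine them. -/
lemma apply_leviCivita [FiniteDimensional ℝ E]
    {cov : CovariantDerivative I E (fun x : M ↦ TangentSpace I x)}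
    (hcov : IsLeviCivita I h.metric cov) (x : M) (a b c : ι) :
    θ c x (cov (X b) x (X a x)) = koszulCoeff θ X a b c x := by
  have hskew : ∀ a b c, θ c x (cov (X b) x (X a x)) + θ b x (cov (X c) x (X a x)) = 0 := by
    intro a b c
    have := hcov.2 x (X b) (X c) (h.mdifferentiableAt_frame b x) (h.mdifferentiableAt_frame c x)
      (X a x)
    simp only [h.metric_inner, h.apply_frame] at this
    rw [mvfderiv_const] at this
    simpa using this.symm
  have htor : ∀ a b c, θ c x (cov (X b) x (X a x)) - θ c x (cov (X a) x (X b x)) =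
      bracketCoeff θ X a b c x := by
    intro a b c
    have : IsManifold I 2 M := inferInstance
    have key := (CovariantDerivative.torsion_eq_zero_iff cov).1 hcov.1 (h.mdifferentiableAt_frame a x)
      (h.mdifferentiableAt_frame b x)
    rw [bracketCoeff, ← key, map_sub]
  rw [koszulCoeff]
  linarith [htor a b c, htor b c a, htor c a b, hskew a b c, hskew b c a, hskew c a b]

omit h [DecidableEq ι] [Fintype ι] in
lemma _root_.CovariantDerivative.sum_const_smul
    (cov : CovariantDerivative I E (fun x : M ↦ TangentSpace I x)) (s : Finset ι) (c : ι → ℝ)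
    {x : M} (hX : ∀ i, MDiffAt (T% (X i)) x) :
    cov (fun y ↦ ∑ i ∈ s, c i • X i y) x = ∑ i ∈ s, c i • cov (X i) x := by
  classical
  have hmd : ∀ i, MDiffAt (T% (c i • X i)) x := fun i ↦
    MDifferentiableAt.smul_section (f := fun _ ↦ c i) mdifferentiableAt_const (hX i)
  induction s using Finset.induction_on with
  | empty =>
    have : (fun y ↦ ∑ i ∈ (∅ : Finset ι), c i • X i y) = 0 := by
      ext y
      simp
    rw [this, cov.zero]
    simp
  | insert i s hi ih =>
    have e : (fun y ↦ ∑ i ∈ insert i s, c i • X i y) =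
        (c i • X i) + fun y ↦ ∑ i ∈ s, c i • X i y := by
      ext y
      simp [Finset.sum_insert hi]
    have hs : MDiffAt (T% (fun y ↦ ∑ i ∈ s, c i • X i y)) x :=
      MDifferentiableAt.sum_section fun i _ ↦ hmd i
    rw [e, Finset.sum_insert hi, cov.isCovariantDerivativeOnUniv.add (hmd i) hs, ih,
      cov.isCovariantDerivativeOnUniv.smul_const (c i) (hX i)]

/-- A field of endomorphisms with constant coefficients in an orthonormal frame is parallel for the
Levi-Civita connection iff its matrix commutes with the connection forms. -/
lemma exists_isLeviCivita_isParallelEndo_iff [FiniteDimensional ℝ E] {κ : Type*}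
    (T : κ → Matrix ι ι ℝ) :
    (∃ cov : CovariantDerivative I E (fun x : M ↦ TangentSpace I x),
      IsLeviCivita I h.metric cov ∧ ∀ s, IsParallelEndo I cov (endo θ X (T s))) ↔
    ∀ s x a b c, ∑ d, koszulCoeff θ X a d c x * T s d b =
      ∑ d, T s c d * koszulCoeff θ X a b d x := by
  constructor
  · rintro ⟨cov, hcov, hpar⟩ s x a b c
    have h1 := hpar s x (X b) (h.mdifferentiableAt_frame b x) (X a x)
    -- For necessity it is enough to test on a frame field, whose image has constant coefficients.
    have e : (fun y ↦ endo θ X (T s) y (X b y)) = fun y ↦ ∑ d, T s d b • X d y := by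
      ext y
      refine h.ext_of_coframe fun c ↦ ?_
      simp [h.apply_endo, h.apply_frame]
    rw [e, cov.sum_const_smul _ _ fun i ↦ h.mdifferentiableAt_frame i x] at h1
    have h2 := congrArg (θ c x) h1
    rw [h.apply_endo] at h2
    simp only [_root_.sum_apply, _root_.smul_apply, map_sum, map_smul, smul_eq_mul,
      h.apply_leviCivita hcov] at h2
    rw [← h2]
    exact Finset.sum_congr rfl fun d _ ↦ mul_comm _ _
  · intro hT
    refine ⟨h.connection, h.isLeviCivita_connection, fun s x Y hY v ↦ h.ext_of_coframe fun c ↦ ?_⟩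
    have hd : ∀ d, MDifferentiableAt I 𝓘(ℝ, ℝ) (fun y ↦ θ d y (Y y)) x :=
      fun d ↦ (h.smooth_coframe d).mdifferentiableAt_apply hY
    have hm : ∀ d, mvfderiv I (fun y ↦ T s c d * θ d y (Y y)) x v =
        T s c d * mvfderiv I (fun y ↦ θ d y (Y y)) x v := by
      intro d
      rw [mvfderiv_fun_mul mdifferentiableAt_const (hd d), mvfderiv_const]
      simp
    rw [h.apply_connection, h.apply_endo]
    simp only [h.apply_endo, h.apply_connection]
    rw [mvfderiv_fun_sum (f := fun d y ↦ T s c d * θ d y (Y y)) _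
      fun d _ ↦ mdifferentiableAt_const.mul (hd d), _root_.sum_apply]
    simp only [hm, mul_add, Finset.sum_add_distrib]
    -- The derivative terms agree because `T s` is constant. What remains is the commutation
    -- relation contracted with the components of `Y` and `v`.
    congr 1
    calc ∑ a, ∑ b, koszulCoeff θ X a b c x * (∑ d, T s b d * θ d x (Y x)) * θ a x v
        = ∑ a, ∑ b, (∑ d, koszulCoeff θ X a d c x * T s d b) * (θ b x (Y x) * θ a x v) := by
          refine Finset.sum_congr rfl fun a _ ↦ ?_
          simp only [Finset.mul_sum, Finset.sum_mul]
          rw [Finset.sum_comm]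
          exact Finset.sum_congr rfl fun b _ ↦ Finset.sum_congr rfl fun d _ ↦ by ring
      _ = ∑ a, ∑ b, (∑ d, T s c d * koszulCoeff θ X a b d x) * (θ b x (Y x) * θ a x v) := by
          simp only [hT]
      _ = ∑ d, T s c d * ∑ a, ∑ b, koszulCoeff θ X a b d x * θ b x (Y x) * θ a x v := by
          simp only [Finset.mul_sum, Finset.sum_mul]
          rw [Finset.sum_comm (γ := ι) (t := Finset.univ) (f := fun d a ↦
            ∑ b, T s c d * (koszulCoeff θ X a b d x * θ b x (Y x) * θ a x v))]
          refine Finset.sum_congr rfl fun a _ ↦ ?_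
          rw [Finset.sum_comm]
          exact Finset.sum_congr rfl fun b _ ↦ Finset.sum_congr rfl fun d _ ↦ by ring

end IsSmoothFrame
end

/-! ### The open set `I` as a manifold, and smooth families of covectors. -/

section
variable {I : Opens ℝ}

/-- The chart of `I` at any point is the inclusion into `ℝ`, defined on all of `I`. -/
lemma extChartAt_opens_real_symm (p : I) {s : ℝ} (hs : s ∈ I) :
    (extChartAt 𝓘(ℝ, ℝ) p).symm s = ⟨s, hs⟩ := by
  have : (⟨s, hs⟩ : I) ∈ (extChartAt 𝓘(ℝ, ℝ) p).source := by
    rw [extChartAt_source]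
    change _ ∈ ((chartAt ℝ p.1).subtypeRestr ⟨p⟩).source
    rw [OpenPartialHomeomorph.subtypeRestr_source]
    trivial
  exact (extChartAt 𝓘(ℝ, ℝ) p).left_inv this

lemma mem_extChartAt_opens_real_target (p : I) {s : ℝ} (hs : s ∈ I) :
    s ∈ (extChartAt 𝓘(ℝ, ℝ) p).target := by
  have : (⟨s, hs⟩ : I) ∈ (extChartAt 𝓘(ℝ, ℝ) p).source := by
    rw [extChartAt_source]
    change _ ∈ ((chartAt ℝ p.1).subtypeRestr ⟨p⟩).source
    rw [OpenPartialHomeomorph.subtypeRestr_source]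
    trivial
  exact (extChartAt 𝓘(ℝ, ℝ) p).map_source this

lemma mfderiv_opens_real_coe (p : I) (r : ℝ) :
    mfderiv 𝓘(ℝ, ℝ) 𝓘(ℝ, ℝ) (Subtype.val : I → ℝ) p r = r := by
  have h : MDifferentiableAt 𝓘(ℝ, ℝ) 𝓘(ℝ, ℝ) (Subtype.val : I → ℝ) p :=
    (contMDiff_subtype_val (n := 1) p).mdifferentiableAt one_ne_zero
  rw [h.mfderiv]
  have e : writtenInExtChartAt 𝓘(ℝ, ℝ) 𝓘(ℝ, ℝ) p (Subtype.val : I → ℝ) =ᶠ[nhds (p : ℝ)] id := by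
    filter_upwards [I.isOpen.mem_nhds p.2] with s hs
    simp only [writtenInExtChartAt, Function.comp, extChartAt_opens_real_symm p hs]
    rfl
  have := e.fderiv_eq (𝕜 := ℝ)
  rw [fderiv_id] at this
  simp only [modelWithCornersSelf_coe, range_id, fderivWithin_univ]
  exact DFunLike.congr_fun this r

end

section
variable {E : Type*} [NormedAddCommGroup E] [NormedSpace ℝ E] [FiniteDimensional ℝ E]
  {E' : Type*} [NormedAddCommGroup E'] [NormedSpace ℝ E']
  {H' : Type*} [TopologicalSpace H'] {J : ModelWithCorners ℝ E' H'}
  {N : Type*} [TopologicalSpace N] [ChartedSpace H' N] {n : ℕ∞ω}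

/-- In finite dimension a functional is the combination of dual basis vectors with its values on a
basis as coefficients. -/
lemma contMDiffAt_clm_of_apply {L : N → E →L[ℝ] ℝ} {q₀ : N}
    (hL : ∀ v, ContMDiffAt J 𝓘(ℝ, ℝ) n (fun q ↦ L q v) q₀) :
    ContMDiffAt J 𝓘(ℝ, E →L[ℝ] ℝ) n L q₀ := by
  let b := Module.finBasis ℝ E
  have e : L = fun q ↦ ∑ i, L q (b i) • (b.coord i).toContinuousLinearMap := by
    ext q v
    calc L q v = L q (∑ i, b.repr v i • b i) := by rw [b.sum_repr]
      _ = _ := by simp [-Module.Basis.sum_repr, map_sum, mul_comm]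
  rw [e]
  exact contMDiffAt_finsetSum fun i _ ↦ (hL (b i)).smul contMDiffAt_const

end

section
variable {G : Type*} [TopologicalSpace G] [ChartedSpace (EuclideanSpace ℝ (Fin 3)) G] {I : Opens ℝ}

lemma pullOneForm_apply (e : ℝ → ∀ x : G, TangentSpace (𝓡 3) x →L[ℝ] ℝ) (p : G × I)
    (v : TangentSpace ((𝓡 3).prod 𝓘(ℝ, ℝ)) p) :
    pullOneForm e p v = e p.2 p.1 v.1 := by
  simp [pullOneForm, mfderiv_fst]
  rfl

lemma timeForm_apply (f : ℝ → ℝ) (p : G × I) (v : TangentSpace ((𝓡 3).prod 𝓘(ℝ, ℝ)) p) :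
    timeForm f p v = f p.2 * v.2 := by
  have h : MDifferentiableAt 𝓘(ℝ, ℝ) 𝓘(ℝ, ℝ) (Subtype.val : I → ℝ) p.2 :=
    (contMDiff_subtype_val (n := 1) p.2).mdifferentiableAt one_ne_zero
  have := mvfderiv_comp_apply (I := 𝓘(ℝ, ℝ)) (I' := (𝓡 3).prod 𝓘(ℝ, ℝ)) (f := fun q : G × I ↦ q.2)
    (g := (Subtype.val : I → ℝ)) p h mdifferentiableAt_snd v
  rw [timeForm]
  refine congrArg (f p.2 * ·) (this.trans ?_)
  rw [mfderiv_snd]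
  exact mfderiv_opens_real_coe p.2 v.2

end

section
variable {E : Type*} [NormedAddCommGroup E] [NormedSpace ℝ E]
    {H : Type*} [TopologicalSpace H] {J : ModelWithCorners ℝ E H} {M : Type*} [TopologicalSpace M]
    [ChartedSpace H M] [IsManifold J 1 M] {E' : Type*} [NormedAddCommGroup E'] [NormedSpace ℝ E']
    {H' : Type*} [TopologicalSpace H'] {J' : ModelWithCorners ℝ E' H'}
    {N : Type*} [TopologicalSpace N] [ChartedSpace H' N] {n : ℕ∞ω}

/-- A smooth family of covectors, evaluated on a smooth family of vectors, is a smooth function. -/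
lemma ContMDiffAt.covector_apply
    {b : N → M} {a : ∀ q, TangentSpace J (b q) →L[ℝ] ℝ} {v : ∀ q, TangentSpace J (b q)} {q₀ : N}
    (ha : ContMDiffAt J' (J.prod 𝓘(ℝ, E →L[ℝ] ℝ)) n (fun q ↦ TotalSpace.mk' (E →L[ℝ] ℝ)
      (E := fun x : M ↦ TangentSpace J x →L[ℝ] Trivial M ℝ x) (b q) (a q)) q₀)
    (hv : ContMDiffAt J' J.tangent n (fun q ↦ TotalSpace.mk' E (b q) (v q)) q₀) :
    ContMDiffAt J' 𝓘(ℝ, ℝ) n (fun q ↦ a q (v q)) q₀ := by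
  have h := ContMDiffAt.clm_bundle_apply (F₁ := E) (F₂ := ℝ) (E₁ := TangentSpace J)
    (E₂ := Trivial M ℝ) (b := b) (ϕ := a) (v := v) (IB := J) (IM := J') (n := n) ha hv
  rw [contMDiffAt_totalSpace] at h
  simpa using h.2

/-- These fields, constant in a trivialization, serve as test vectors: a family of covectors is
smooth once its pairings with them are. -/
lemma contMDiffAt_symmL_const [IsManifold J ∞ M] (x₀ : M) {x : M}
    (hx : x ∈ (chartAt H x₀).source) (v : E) :
    ContMDiffAt J J.tangent ∞ (fun p : M ↦ TotalSpace.mk' E p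
      ((trivializationAt E (TangentSpace J) x₀).symmL ℝ p v)) x := by
  let t := trivializationAt E (TangentSpace J) x₀
  have hx' : x ∈ t.baseSet := hx
  rw [Bundle.Trivialization.contMDiffAt_section_iff (IB := J) t hx']
  refine contMDiffAt_const (c := v) |>.congr_of_eventuallyEq ?_
  filter_upwards [t.open_baseSet.mem_nhds hx'] with p hp
  exact congrArg Prod.snd ((congrArg (fun w ↦ t ⟨p, w⟩)
    (Bundle.Trivialization.symmL_apply t hp v)).trans (Bundle.Trivialization.apply_mk_symm t hp v))

end

/-! ### The coframe on `G × I` in product charts. -/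

section
variable {G : Type*} [TopologicalSpace G] [ChartedSpace (EuclideanSpace ℝ (Fin 3)) G] {I : Opens ℝ}
  [IsManifold (𝓡 3) ∞ G]

/-- Pairing with a test field amounts to pushing the field forward by the tangent map of `Prod.fst`
and pairing with `e i`, which is smooth along `Prod.fst`. -/
lemma IsSmoothCoframe.smoothOneForm_pullOneForm
    {e : Fin 3 → ℝ → ∀ x : G, TangentSpace (𝓡 3) x →L[ℝ] ℝ} (he : IsSmoothCoframe I e) (i : Fin 3) :
    SmoothOneForm (M := G × I) ((𝓡 3).prod 𝓘(ℝ, ℝ)) (pullOneForm (e i)) := by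
  intro p₀
  rw [contMDiffAt_covector_iff]
  refine ⟨contMDiffAt_id, contMDiffAt_clm_of_apply fun v ↦ ?_⟩
  let t := trivializationAt (EuclideanSpace ℝ (Fin 3) × ℝ) (TangentSpace ((𝓡 3).prod 𝓘(ℝ, ℝ))) p₀
  have h1 := contMDiffAt_symmL_const (J := (𝓡 3).prod 𝓘(ℝ, ℝ)) p₀ (mem_chart_source _ p₀) v
  have h2 := (ContMDiff.contMDiff_tangentMap (m := ∞) (n := ∞)
    (contMDiff_fst (I := 𝓡 3) (J := 𝓘(ℝ, ℝ)) (M := G) (N := I)) le_rfl).contMDiffAt.comp p₀ h1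
  exact ContMDiffAt.covector_apply (b := Prod.fst)
    (v := fun p ↦ mfderiv ((𝓡 3).prod 𝓘(ℝ, ℝ)) (𝓡 3) (Prod.fst : G × I → G) p (t.symmL ℝ p v))
    (he.smooth i p₀) h2

lemma smoothOneForm_timeForm {f : ℝ → ℝ} (hf : ContDiffOn ℝ ∞ f I) :
    SmoothOneForm (M := G × I) ((𝓡 3).prod 𝓘(ℝ, ℝ)) (timeForm f) := by
  intro p₀
  rw [contMDiffAt_covector_iff]
  refine ⟨contMDiffAt_id, contMDiffAt_clm_of_apply fun v ↦ ?_⟩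
  let t := trivializationAt (EuclideanSpace ℝ (Fin 3) × ℝ) (TangentSpace ((𝓡 3).prod 𝓘(ℝ, ℝ))) p₀
  have h1 := contMDiffAt_symmL_const (J := (𝓡 3).prod 𝓘(ℝ, ℝ)) p₀ (mem_chart_source _ p₀) v
  have h0 : ContMDiff ((𝓡 3).prod 𝓘(ℝ, ℝ)) 𝓘(ℝ, ℝ) ∞ (fun q : G × I ↦ (q.2 : ℝ)) :=
    contMDiff_subtype_val.comp contMDiff_snd
  have h2 := (ContMDiff.contMDiff_tangentMap (m := ∞) (n := ∞) h0 le_rfl).contMDiffAt.comp p₀ h1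
  have h3 := (contMDiff_snd_tangentBundle_modelSpace ℝ 𝓘(ℝ, ℝ) (n := ∞)).contMDiffAt.comp p₀ h2
  have h4 : ContMDiffAt ((𝓡 3).prod 𝓘(ℝ, ℝ)) 𝓘(ℝ, ℝ) ∞ (fun q : G × I ↦ f q.2) p₀ :=
    (hf.contDiffAt (I.isOpen.mem_nhds p₀.2.2)).contMDiffAt.comp p₀ h0.contMDiffAt
  exact h4.mul h3

/-- Joint smoothness in space and time, at every point of the chart target and not only at its
centre; exchanging `∂_t` with `d` rests on it. -/
lemma IsSmoothCoframe.contDiffAt_chartForm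
    {e : Fin 3 → ℝ → ∀ x : G, TangentSpace (𝓡 3) x →L[ℝ] ℝ} (he : IsSmoothCoframe I e) (k : Fin 3)
    (x₀ : G) {y : EuclideanSpace ℝ (Fin 3)} (hy : y ∈ (extChartAt (𝓡 3) x₀).target) {t : ℝ}
    (ht : t ∈ I) :
    ContDiffAt ℝ ∞ (fun z : EuclideanSpace ℝ (Fin 3) × ℝ ↦ chartForm (𝓡 3) x₀ (e k z.2) z.1)
      (y, t) := by
  rw [← contMDiffAt_iff_contDiffAt]
  refine contMDiffAt_clm_of_apply fun v ↦ ?_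
  let p : G × I := ((extChartAt (𝓡 3) x₀).symm y, ⟨t, ht⟩)
  let T := trivializationAt (EuclideanSpace ℝ (Fin 3)) (TangentSpace (𝓡 3)) x₀
  have hp : p.1 ∈ (chartAt (EuclideanSpace ℝ (Fin 3)) x₀).source := by
    rw [← extChartAt_source (𝓡 3)]
    exact (extChartAt (𝓡 3) x₀).map_target hy
  have h1 := (contMDiffAt_symmL_const (J := 𝓡 3) x₀ hp v).comp p
    (contMDiffAt_fst (I := 𝓡 3) (J := 𝓘(ℝ, ℝ)) (M := G) (N := I))
  have h2 := ContMDiffAt.covector_apply (b := Prod.fst) (v := fun p : G × I ↦ T.symmL ℝ p.1 v)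
    (he.smooth k p) h1
  have h3 : ContMDiffAt 𝓘(ℝ, EuclideanSpace ℝ (Fin 3) × ℝ) ((𝓡 3).prod 𝓘(ℝ, ℝ)) ∞
      (fun z : EuclideanSpace ℝ (Fin 3) × ℝ ↦ ((extChartAt (𝓡 3) x₀).symm z.1,
        (extChartAt 𝓘(ℝ, ℝ) p.2).symm z.2)) (y, t) := by
    refine ContMDiffAt.prodMk ?_ ?_
    · exact ((contMDiffOn_extChartAt_symm x₀).contMDiffAt
        ((isOpen_extChartAt_target x₀).mem_nhds hy)).comp (y, t) contDiff_fst.contMDiff.contMDiffAt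
    · exact ((contMDiffOn_extChartAt_symm p.2).contMDiffAt
        ((isOpen_extChartAt_target p.2).mem_nhds (mem_extChartAt_opens_real_target p.2 ht))).comp
          (y, t) contDiff_snd.contMDiff.contMDiffAt
  have h4 := ContMDiffAt.comp_of_eq h2 h3
    (Prod.ext rfl (extChartAt_opens_real_symm p.2 ht))
  refine h4.congr_of_eventuallyEq ?_
  filter_upwards [((isOpen_extChartAt_target (I := 𝓡 3) x₀).prod I.isOpen).mem_nhds ⟨hy, ht⟩] with z hz
  rw [chartForm_eq_symmL _ hz.1]
  simp only [Function.comp]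
  rw [extChartAt_opens_real_symm p.2 hz.2]
  rfl
end

section
variable {G : Type*} [TopologicalSpace G] [ChartedSpace (EuclideanSpace ℝ (Fin 3)) G] {I : Opens ℝ}
  [IsManifold (𝓡 3) ∞ G]

/-- The inverse product chart followed by `Prod.fst` is the inverse chart of `G` applied to the
first coordinate; the chain rule for the two factorizations gives the claim. -/
lemma chartForm_prod_pullOneForm (e : ℝ → ∀ x : G, TangentSpace (𝓡 3) x →L[ℝ] ℝ) (q₀ : G × I)
    {z : EuclideanSpace ℝ (Fin 3) × ℝ} (hz : z.1 ∈ (extChartAt (𝓡 3) q₀.1).target) (hz' : z.2 ∈ I)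
    (w : EuclideanSpace ℝ (Fin 3) × ℝ) :
    chartForm ((𝓡 3).prod 𝓘(ℝ, ℝ)) q₀ (pullOneForm e) z w =
      chartForm (𝓡 3) q₀.1 (e z.2) z.1 w.1 := by
  let J := (𝓡 3).prod 𝓘(ℝ, ℝ)
  have hzt : z ∈ (extChartAt J q₀).target := by
    rw [extChartAt_prod]
    exact ⟨hz, mem_extChartAt_opens_real_target q₀.2 hz'⟩
  have hs : (extChartAt J q₀).symm z = ((extChartAt (𝓡 3) q₀.1).symm z.1, ⟨z.2, hz'⟩) := by
    rw [extChartAt_prod]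
    exact Prod.ext rfl (extChartAt_opens_real_symm q₀.2 hz')
  have hf : (Prod.fst : G × I → G) ∘ (extChartAt J q₀).symm =
      (extChartAt (𝓡 3) q₀.1).symm ∘ Prod.fst := by
    rw [extChartAt_prod]; rfl
  have d1 : MDifferentiableAt 𝓘(ℝ, EuclideanSpace ℝ (Fin 3) × ℝ) J (extChartAt J q₀).symm z :=
    ((contMDiffOn_extChartAt_symm (n := 1) q₀).contMDiffAt
      ((isOpen_extChartAt_target q₀).mem_nhds hzt)).mdifferentiableAt one_ne_zero
  have d2 : MDifferentiableAt 𝓘(ℝ, EuclideanSpace ℝ (Fin 3)) (𝓡 3) (extChartAt (𝓡 3) q₀.1).symm z.1 :=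
    ((contMDiffOn_extChartAt_symm (n := 1) q₀.1).contMDiffAt
      ((isOpen_extChartAt_target q₀.1).mem_nhds hz)).mdifferentiableAt one_ne_zero
  have c1 := mfderiv_comp (I := 𝓘(ℝ, EuclideanSpace ℝ (Fin 3) × ℝ)) (I' := J) (I'' := 𝓡 3) z
    (mdifferentiableAt_fst (M := G) (M' := I)) d1
  have c2 := mfderiv_comp (I := 𝓘(ℝ, EuclideanSpace ℝ (Fin 3) × ℝ))
    (I' := 𝓘(ℝ, EuclideanSpace ℝ (Fin 3))) (I'' := 𝓡 3) z d2
    differentiableAt_fst.mdifferentiableAt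
  rw [hf] at c1
  have c3 := DFunLike.congr_fun (c1.symm.trans c2) w
  have c4 : mfderiv 𝓘(ℝ, EuclideanSpace ℝ (Fin 3) × ℝ) 𝓘(ℝ, EuclideanSpace ℝ (Fin 3))
    (Prod.fst : EuclideanSpace ℝ (Fin 3) × ℝ → EuclideanSpace ℝ (Fin 3)) z w = w.1 := by
    rw [mfderiv_eq_fderiv, fderiv_fst]; rfl
  have r1 : range J = univ := J.range_eq_univ
  have r2 : range (𝓡 3) = univ := (𝓡 3).range_eq_univ
  have hs' : (((extChartAt J q₀).symm z).2 : ℝ) = z.2 := by rw [hs]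
  have hs'' : ((extChartAt J q₀).symm z).1 = (extChartAt (𝓡 3) q₀.1).symm z.1 := by rw [hs]
  have c5 : (mfderiv J (𝓡 3) (Prod.fst : G × I → G) ((extChartAt J q₀).symm z)
      (mfderivWithin 𝓘(ℝ, EuclideanSpace ℝ (Fin 3) × ℝ) J (extChartAt J q₀).symm (range J) z w) :
        EuclideanSpace ℝ (Fin 3)) =
      mfderivWithin 𝓘(ℝ, EuclideanSpace ℝ (Fin 3)) (𝓡 3) (extChartAt (𝓡 3) q₀.1).symm
        (range (𝓡 3)) z.1 w.1 := by
    rw [r1, r2, mfderivWithin_univ, mfderivWithin_univ]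
    exact c3.trans (congrArg (mfderiv 𝓘(ℝ, EuclideanSpace ℝ (Fin 3)) (𝓡 3)
      (extChartAt (𝓡 3) q₀.1).symm z.1) c4)
  have key : ∀ (t : ℝ) (x : G), t = z.2 → x = (extChartAt (𝓡 3) q₀.1).symm z.1 →
      ∀ u u' : EuclideanSpace ℝ (Fin 3), u = u' →
        e t x u = e z.2 ((extChartAt (𝓡 3) q₀.1).symm z.1) u' := by
    rintro _ _ rfl rfl _ _ rfl; rfl
  exact key _ _ hs' hs'' _ _ c5

lemma chartForm_prod_timeForm (f : ℝ → ℝ) (q₀ : G × I)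
    {z : EuclideanSpace ℝ (Fin 3) × ℝ} (hz : z.1 ∈ (extChartAt (𝓡 3) q₀.1).target) (hz' : z.2 ∈ I)
    (w : EuclideanSpace ℝ (Fin 3) × ℝ) :
    chartForm ((𝓡 3).prod 𝓘(ℝ, ℝ)) q₀ (timeForm f) z w = f z.2 * w.2 := by
  let J := (𝓡 3).prod 𝓘(ℝ, ℝ)
  have hzt : z ∈ (extChartAt J q₀).target := by
    rw [extChartAt_prod]
    exact ⟨hz, mem_extChartAt_opens_real_target q₀.2 hz'⟩
  have hs' : (((extChartAt J q₀).symm z).2 : ℝ) = z.2 := by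
    rw [extChartAt_prod]
    exact congrArg Subtype.val (extChartAt_opens_real_symm q₀.2 hz')
  have d1 : MDifferentiableAt 𝓘(ℝ, EuclideanSpace ℝ (Fin 3) × ℝ) J (extChartAt J q₀).symm z :=
    ((contMDiffOn_extChartAt_symm (n := 1) q₀).contMDiffAt
      ((isOpen_extChartAt_target q₀).mem_nhds hzt)).mdifferentiableAt one_ne_zero
  have d2 : MDifferentiable J 𝓘(ℝ, ℝ) (fun q : G × I ↦ (q.2 : ℝ)) :=
    (contMDiff_subtype_val.comp (contMDiff_snd (n := 1))).mdifferentiable one_ne_zero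
  have c1 := mfderiv_comp (I := 𝓘(ℝ, EuclideanSpace ℝ (Fin 3) × ℝ)) (I' := J) (I'' := 𝓘(ℝ, ℝ)) z
    (d2 _) d1
  have c2 : (fun q : G × I ↦ (q.2 : ℝ)) ∘ (extChartAt J q₀).symm =ᶠ[nhds z] Prod.snd := by
    filter_upwards [continuousAt_snd.preimage_mem_nhds (I.isOpen.mem_nhds hz')] with y hy
    rw [extChartAt_prod]
    exact congrArg Subtype.val (extChartAt_opens_real_symm q₀.2 hy)
  have c4 : mfderiv 𝓘(ℝ, EuclideanSpace ℝ (Fin 3) × ℝ) 𝓘(ℝ, ℝ)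
    (Prod.snd : EuclideanSpace ℝ (Fin 3) × ℝ → ℝ) z w = w.2 := by
    rw [mfderiv_eq_fderiv, fderiv_snd]; rfl
  have c3 := (DFunLike.congr_fun (c1.symm.trans c2.mfderiv_eq) w).trans c4
  have c5 : (mfderiv J 𝓘(ℝ, ℝ) (fun q : G × I ↦ (q.2 : ℝ)) ((extChartAt J q₀).symm z)
      (mfderivWithin 𝓘(ℝ, EuclideanSpace ℝ (Fin 3) × ℝ) J (extChartAt J q₀).symm (range J) z w) :
        ℝ) = w.2 := by
    rw [show range J = univ from J.range_eq_univ, mfderivWithin_univ]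
    exact c3
  have key : ∀ t : ℝ, t = z.2 → ∀ u u' : ℝ, u = u' → f t * u = f z.2 * u' := by
    rintro _ rfl _ _ rfl; rfl
  exact key _ hs' _ _ c5

end

section
variable {G : Type*} [TopologicalSpace G] [ChartedSpace (EuclideanSpace ℝ (Fin 3)) G] {I : Opens ℝ}

lemma extChartAt_prod_self_eq (q : G × I) :
    extChartAt ((𝓡 3).prod 𝓘(ℝ, ℝ)) q q = (extChartAt (𝓡 3) q.1 q.1, (q.2 : ℝ)) := by
  rw [extChartAt_prod]; rfl

lemma eventually_mem_extChartAt_target_prod (q : G × I) :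
    ∀ᶠ z in nhds (extChartAt ((𝓡 3).prod 𝓘(ℝ, ℝ)) q q),
      z.1 ∈ (extChartAt (𝓡 3) q.1).target ∧ z.2 ∈ I := by
  rw [extChartAt_prod_self_eq]
  exact ((isOpen_extChartAt_target (I := 𝓡 3) q.1).prod I.isOpen).mem_nhds
    ⟨mem_extChartAt_target q.1, q.2.2⟩

variable [IsManifold (𝓡 3) ∞ G] {e : Fin 3 → ℝ → ∀ x : G, TangentSpace (𝓡 3) x →L[ℝ] ℝ}

lemma IsSmoothCoframe.smoothOneForm (he : IsSmoothCoframe I e) (k : Fin 3) {t : ℝ} (ht : t ∈ I) :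
    SmoothOneForm (𝓡 3) (e k t) :=
  (he.smooth k).comp (contMDiff_id.prodMk (contMDiff_const (c := (⟨t, ht⟩ : I))))

/-- The direction is split as `(v.1, 0) + v.2 • (0, 1)`. Antisymmetrizing in `v, w` gives `de^k + dt
∧ ∂_t e^k`, the differential on `G × I`. -/
lemma IsSmoothCoframe.fderiv_chartForm_pullOneForm (he : IsSmoothCoframe I e) (k : Fin 3)
    (q : G × I) (v w : EuclideanSpace ℝ (Fin 3) × ℝ) :
    fderiv ℝ (chartForm ((𝓡 3).prod 𝓘(ℝ, ℝ)) q (pullOneForm (e k)))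
        (extChartAt ((𝓡 3).prod 𝓘(ℝ, ℝ)) q q) v w =
      fderiv ℝ (chartForm (𝓡 3) q.1 (e k q.2)) (extChartAt (𝓡 3) q.1 q.1) v.1 w.1 +
        v.2 * deriv (fun s ↦ e k s q.1 w.1) q.2 := by
  let A := fun z : EuclideanSpace ℝ (Fin 3) × ℝ ↦ chartForm (𝓡 3) q.1 (e k z.2) z.1
  let y₀ := extChartAt (𝓡 3) q.1 q.1
  have hA : DifferentiableAt ℝ A (y₀, (q.2 : ℝ)) :=
    (he.contDiffAt_chartForm k q.1 (mem_extChartAt_target (I := 𝓡 3) q.1) q.2.2).differentiableAt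
      (by simp)
  have hc := (he.smoothOneForm_pullOneForm k).differentiableAt_chartForm q
  have e1 : (fun z ↦ chartForm ((𝓡 3).prod 𝓘(ℝ, ℝ)) q (pullOneForm (e k)) z w) =ᶠ[nhds
      (extChartAt ((𝓡 3).prod 𝓘(ℝ, ℝ)) q q)] fun z ↦ A z w.1 := by
    filter_upwards [eventually_mem_extChartAt_target_prod q] with z hz
    exact chartForm_prod_pullOneForm (e k) q hz.1 hz.2 w
  have e2 := DFunLike.congr_fun (e1.fderiv_eq (𝕜 := ℝ)) v
  rw [fderiv_clm_apply hc (differentiableAt_const w), extChartAt_prod_self_eq,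
    fderiv_clm_apply hA (differentiableAt_const w.1)] at e2
  have e3 : fderiv ℝ (chartForm (𝓡 3) q.1 (e k q.2)) y₀ v.1 = fderiv ℝ A (y₀, (q.2 : ℝ)) (v.1, 0) := by
    have h1 : HasFDerivAt (fun y : EuclideanSpace ℝ (Fin 3) ↦ (y, (q.2 : ℝ)))
      (ContinuousLinearMap.inl ℝ (EuclideanSpace ℝ (Fin 3)) ℝ) y₀ := hasFDerivAt_prodMk_left _ _
    have := (hA.hasFDerivAt.comp (g := A) y₀ h1).fderiv
    exact DFunLike.congr_fun this v.1
  have e4 : deriv (fun s ↦ e k s q.1 w.1) q.2 = fderiv ℝ A (y₀, (q.2 : ℝ)) (0, 1) w.1 := by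
    have h1 : HasDerivAt (fun s : ℝ ↦ (y₀, s)) ((0 : EuclideanSpace ℝ (Fin 3)), (1 : ℝ)) q.2 :=
      (hasDerivAt_const _ _).prodMk (hasDerivAt_id _)
    have h2 := (hA.hasFDerivAt.comp_hasDerivAt (q.2 : ℝ) h1).clm_apply (hasDerivAt_const (q.2 : ℝ) w.1)
    refine Eq.trans ?_ (h2.deriv.trans (by simp))
    congr 1
    funext s
    exact (chartForm_extChartAt_self (I := 𝓡 3) (e k s) q.1 w.1).symm
  have e5 : v = (v.1, 0) + v.2 • ((0 : EuclideanSpace ℝ (Fin 3)), (1 : ℝ)) := by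
    ext <;> simp
  rw [e3, e4, extChartAt_prod_self_eq]
  have e6 : fderiv ℝ A (y₀, (q.2 : ℝ)) v = fderiv ℝ A (y₀, (q.2 : ℝ)) (v.1, 0) +
      v.2 • fderiv ℝ A (y₀, (q.2 : ℝ)) (0, 1) := by
    conv_lhs => rw [e5]
    rw [map_add, map_smul]
  have e7 : fderiv ℝ (chartForm ((𝓡 3).prod 𝓘(ℝ, ℝ)) q (pullOneForm (e k))) (y₀, (q.2 : ℝ)) v w =
      fderiv ℝ A (y₀, (q.2 : ℝ)) v w.1 := by simpa [y₀] using e2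
  rw [e7, e6]
  rfl

/-- The result is symmetric in `v` and `w`, which is the closedness of `f dt`. -/
lemma fderiv_chartForm_timeForm {f : ℝ → ℝ} (hf : ContDiffOn ℝ ∞ f I)
    (q : G × I) (v w : EuclideanSpace ℝ (Fin 3) × ℝ) :
    fderiv ℝ (chartForm ((𝓡 3).prod 𝓘(ℝ, ℝ)) q (timeForm f))
        (extChartAt ((𝓡 3).prod 𝓘(ℝ, ℝ)) q q) v w = v.2 * deriv f q.2 * w.2 := by
  have hc := (smoothOneForm_timeForm (G := G) hf).differentiableAt_chartForm q
  have e1 : (fun z ↦ chartForm ((𝓡 3).prod 𝓘(ℝ, ℝ)) q (timeForm f) z w) =ᶠ[nhds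
      (extChartAt ((𝓡 3).prod 𝓘(ℝ, ℝ)) q q)] fun z ↦ f z.2 * w.2 := by
    filter_upwards [eventually_mem_extChartAt_target_prod q] with z hz
    exact chartForm_prod_timeForm f q hz.1 hz.2 w
  have hfd : HasDerivAt f (deriv f q.2) q.2 :=
    ((hf.contDiffAt (I.isOpen.mem_nhds q.2.2)).differentiableAt (by simp)).hasDerivAt
  have h2 : HasFDerivAt (fun z : EuclideanSpace ℝ (Fin 3) × ℝ ↦ f z.2 * w.2)
      (w.2 • deriv f q.2 • ContinuousLinearMap.snd ℝ (EuclideanSpace ℝ (Fin 3)) ℝ)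
      (extChartAt (𝓡 3) q.1 q.1, (q.2 : ℝ)) :=
    (HasDerivAt.comp_hasFDerivAt (f := Prod.snd) _ hfd hasFDerivAt_snd).mul_const w.2
  have e2 := DFunLike.congr_fun (e1.fderiv_eq (𝕜 := ℝ)) v
  rw [fderiv_clm_apply hc (differentiableAt_const w), extChartAt_prod_self_eq, h2.fderiv] at e2
  rw [extChartAt_prod_self_eq]
  have e3 : fderiv ℝ (chartForm ((𝓡 3).prod 𝓘(ℝ, ℝ)) q (timeForm f))
    (extChartAt (𝓡 3) q.1 q.1, (q.2 : ℝ)) v w = w.2 * (deriv f q.2 * v.2) := by simpa using e2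
  rw [e3]; ring

/-- The four 1-forms `e¹, e², e³, f dt` on `G × I`. -/
noncomputable def evolutionCoframe (e : Fin 3 → ℝ → ∀ x : G, TangentSpace (𝓡 3) x →L[ℝ] ℝ)
    (f : ℝ → ℝ) : Fin 4 → ∀ p : G × I, TangentSpace ((𝓡 3).prod 𝓘(ℝ, ℝ)) p →L[ℝ] ℝ :=
  ![pullOneForm (e 0), pullOneForm (e 1), pullOneForm (e 2), timeForm f]

lemma IsSmoothCoframe.exists_isSmoothFrame (he : IsSmoothCoframe I e) {f : ℝ → ℝ}
    (hf : ContDiffOn ℝ ∞ f I) (hf0 : ∀ t ∈ I, f t ≠ 0) :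
    ∃ X, IsSmoothFrame (I := (𝓡 3).prod 𝓘(ℝ, ℝ)) (evolutionCoframe (G := G) (I := I) e f) X := by
  apply _root_.exists_isSmoothFrame
  · simp
  · intro i
    fin_cases i
    exacts [he.smoothOneForm_pullOneForm 0, he.smoothOneForm_pullOneForm 1,
      he.smoothOneForm_pullOneForm 2, smoothOneForm_timeForm hf]
  · intro p
    rw [Fintype.linearIndependent_iff]
    intro c hc
    have hv : ∀ v : EuclideanSpace ℝ (Fin 3) × ℝ, c 0 * e 0 p.2 p.1 v.1 + c 1 * e 1 p.2 p.1 v.1 +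
        c 2 * e 2 p.2 p.1 v.1 + c 3 * (f p.2 * v.2) = 0 := by
      intro v
      have := DFunLike.congr_fun hc v
      simp only [Fin.sum_univ_four] at this
      refine Eq.trans ?_ this
      refine congrArg₂ _ (congrArg₂ _ (congrArg₂ _ ?_ ?_) ?_) ?_
      · exact congrArg (c 0 * ·) (pullOneForm_apply (e 0) p v).symm
      · exact congrArg (c 1 * ·) (pullOneForm_apply (e 1) p v).symm
      · exact congrArg (c 2 * ·) (pullOneForm_apply (e 2) p v).symm
      · exact congrArg (c 3 * ·) (timeForm_apply f p v).symm
    -- The direction `(0, 1)` is annihilated by the `e^k` and isolates the coefficient of `f dt`;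
    -- the other three vanish by independence on `G`.
    have h3 : c 3 = 0 := by
      have h := hv (0, 1)
      have h0 : ∀ k, e k p.2 p.1 ((0, 1) : EuclideanSpace ℝ (Fin 3) × ℝ).1 = 0 :=
        fun k ↦ map_zero (e k p.2 p.1)
      rw [h0, h0, h0] at h
      simpa [hf0 p.2 p.2.2] using h
    have h012 := Fintype.linearIndependent_iff.1 (he.basis p.2 p.2.2 p.1) (fun i ↦ c i.castSucc) (by
      ext v
      have := hv (v, 0)
      simp only [Fin.sum_univ_three]
      simpa using! this)
    intro i
    refine Fin.lastCases h3 (fun i ↦ h012 i) i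

end

/-! ### Linear algebra of the hyper-Hermitian structure equations. -/

section

/-- The matrices of the three complex structures in a hyper-Hermitian orthonormal frame. -/
def hyperMatrix : Fin 3 → Matrix (Fin 4) (Fin 4) ℝ :=
  ![!![0, -1, 0, 0; 1, 0, 0, 0; 0, 0, 0, -1; 0, 0, 1, 0],
    !![0, 0, -1, 0; 0, 0, 0, 1; 1, 0, 0, 0; 0, -1, 0, 0],
    !![0, 0, 0, -1; 0, 0, -1, 0; 0, 1, 0, 0; 1, 0, 0, 0]]

/-- In `so(4) = sp(1) ⊕ sp(1)` the three matrices span one summand, whose commutant is the other,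
its orthogonal complement. The three equations say that the skew matrix `Γ` is orthogonal to each
`hyperMatrix s`. -/
lemma commute_hyperMatrix_iff {Γ : Fin 4 → Fin 4 → ℝ} (hΓ : ∀ b c, Γ b c = -Γ c b) :
    (∀ s b c, ∑ d, Γ d c * hyperMatrix s d b = ∑ d, hyperMatrix s c d * Γ b d) ↔
      Γ 0 1 + Γ 2 3 = 0 ∧ Γ 0 2 - Γ 1 3 = 0 ∧ Γ 0 3 + Γ 1 2 = 0 := by
  have h00 := hΓ 0 0
  have h11 := hΓ 1 1
  have h22 := hΓ 2 2
  have h33 := hΓ 3 3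
  have h10 := hΓ 1 0
  have h20 := hΓ 2 0
  have h30 := hΓ 3 0
  have h21 := hΓ 2 1
  have h31 := hΓ 3 1
  have h32 := hΓ 3 2
  constructor
  · intro h
    have a1 := h 1 0 3
    have a2 := h 0 0 2
    have a3 := h 0 0 3
    simp [hyperMatrix, Fin.sum_univ_four] at a1 a2 a3
    refine ⟨?_, ?_, ?_⟩ <;> linarith
  · rintro ⟨h1, h2, h3⟩ s b c
    fin_cases s <;> fin_cases b <;> fin_cases c <;>
      simp [hyperMatrix, Fin.sum_univ_four] <;> linarith

set_option maxHeartbeats 1600000 in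
/-- The structure equations of a parallel quaternionic triple in terms of the structure functions
`C` and the time derivatives `D` of a time-dependent coframe in dimension three. -/
lemma structure_equations_iff {B : Fin 4 → Fin 4 → Fin 4 → ℝ} {C : Fin 3 → Fin 3 → Fin 3 → ℝ}
    {D : Fin 3 → Fin 3 → ℝ} (hB : ∀ a b c, B a b c = -B b a c)
    (hC : ∀ k a b : Fin 3, B a.castSucc b.castSucc k.castSucc = -C k a b)
    (hD : ∀ k a : Fin 3, B 3 a.castSucc k.castSucc = -D k a) (h3 : ∀ a b, B a b 3 = 0) :
    (∀ s a b c, ∑ d, ((B a d c - B d c a + B c a d) / 2) * hyperMatrix s d b =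
        ∑ d, hyperMatrix s c d * ((B a b d - B b d a + B d a b) / 2)) ↔
      (∀ i j : Fin 3, (C i 0 1 * (if j = 2 then 1 else 0) + C i 1 2 * (if j = 0 then 1 else 0) +
          C i 2 0 * (if j = 1 then 1 else 0)) - ((if i = 2 then 1 else 0) * C j 0 1 +
          (if i = 0 then 1 else 0) * C j 1 2 + (if i = 1 then 1 else 0) * C j 2 0) = 0) ∧
      ∀ i a b : Fin 3, (D i a * (if i + 1 = b then 1 else 0) - D i b * (if i + 1 = a then 1 else 0)) +
        ((if i = a then 1 else 0) * D (i + 1) b - (if i = b then 1 else 0) * D (i + 1) a) =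
          -C (i + 2) a b := by
  have hswap : (∀ s a b c, ∑ d, ((B a d c - B d c a + B c a d) / 2) * hyperMatrix s d b =
        ∑ d, hyperMatrix s c d * ((B a b d - B b d a + B d a b) / 2)) ↔
      ∀ a s b c, ∑ d, ((B a d c - B d c a + B c a d) / 2) * hyperMatrix s d b =
        ∑ d, hyperMatrix s c d * ((B a b d - B b d a + B d a b) / 2) := forall_comm
  -- For each direction `a` the Koszul matrix is skew, so commutation becomes three equations, hence
  -- twelve in all, linear in `C` and `D`.
  have hk := fun a ↦ commute_hyperMatrix_iff (Γ := fun b c ↦ (B a b c - B b c a + B c a b) / 2)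
    (fun b c ↦ by linarith [hB a b c, hB a c b, hB b c a, hB c a b, hB b a c])
  have hC' : ∀ k a b, C k a b = -C k b a := fun k a b ↦ by
    have h1 := hC k a b
    have h2 := hC k b a
    have := hB a.castSucc b.castSucc k.castSucc
    linarith
  have hself : ∀ k a, C k a a = 0 := fun k a ↦ by linarith [hC' k a a]
  have b0 : ∀ a c, B a a c = 0 := fun a c ↦ by linarith [hB a a c]
  have hD' : ∀ k a : Fin 3, B a.castSucc 3 k.castSucc = D k a := fun k a ↦ by
    rw [hB, hD, neg_neg]
  have l10 := fun k ↦ hC' k 1 0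
  have l02 := fun k ↦ hC' k 0 2
  have l21 := fun k ↦ hC' k 2 1
  simp only [Fin.forall_fin_succ, IsEmpty.forall_iff, and_true] at hC hD hD'
  simp only [Fin.castSucc_zero, Fin.succ_zero_eq_one, Fin.succ_one_eq_two, Fin.castSucc_one,
    show (2 : Fin 3).castSucc = 2 from rfl] at hC hD hD'
  obtain ⟨⟨⟨c000, c001, c002⟩, ⟨c010, c011, c012⟩, c020, c021, c022⟩,
    ⟨⟨c100, c101, c102⟩, ⟨c110, c111, c112⟩, c120, c121, c122⟩,
    ⟨c200, c201, c202⟩, ⟨c210, c211, c212⟩, c220, c221, c222⟩ := hC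
  obtain ⟨⟨d00, d01, d02⟩, ⟨d10, d11, d12⟩, d20, d21, d22⟩ := hD
  obtain ⟨⟨d00', d01', d02'⟩, ⟨d10', d11', d12'⟩, d20', d21', d22'⟩ := hD'
  refine (hswap.trans (forall_congr' hk)).trans ?_
  have s1 : (2 : Fin 3) + 1 = 0 := rfl
  have s2 : (1 : Fin 3) + 2 = 0 := rfl
  have s3 : (2 : Fin 3) + 2 = 1 := rfl
  constructor
  · intro h
    obtain ⟨g01, g02, g03⟩ := h 0
    obtain ⟨g11, g12, g13⟩ := h 1
    obtain ⟨g21, g22, g23⟩ := h 2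
    obtain ⟨g31, g32, g33⟩ := h 3
    simp only [b0, h3, c001, c002, c010, c012, c020, c021, c101, c102, c110, c112, c120, c121,
      c201, c202, c210, c212, c220, c221, d00, d01, d02, d10, d11, d12, d20, d21, d22,
      d00', d01', d02', d10', d11', d12', d20', d21', d22', l10, l02, l21]
      at g01 g02 g03 g11 g12 g13 g21 g22 g23 g31 g32 g33
    clear c000 c001 c002 c010 c011 c012 c020 c021 c022 c100 c101 c102 c110 c111 c112 c120 c121 c122
      c200 c201 c202 c210 c211 c212 c220 c221 c222 d00 d01 d02 d10 d11 d12 d20 d21 d22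
      d00' d01' d02' d10' d11' d12' d20' d21' d22'
    constructor
    · intro i j
      fin_cases i <;> fin_cases j <;> simp <;>
        linarith only [g01, g02, g03, g11, g12, g13, g21, g22, g23, g31, g32, g33]
    · intro i a b
      fin_cases i <;> fin_cases a <;> fin_cases b <;> simp [l10, l02, l21, hself, s1, s2, s3] <;>
        linarith only [g01, g02, g03, g11, g12, g13, g21, g22, g23, g31, g32, g33]
  · rintro ⟨h1, h2⟩
    -- The first family is skew in `i, j` and the second in `a, b`, so these three and nine
    -- instances carry all the information.
    have z1 := h1 0 1
    have z2 := h1 0 2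
    have z3 := h1 1 2
    have x1 := h2 0 0 1
    have x2 := h2 0 0 2
    have x3 := h2 0 1 2
    have y1 := h2 1 0 1
    have y2 := h2 1 0 2
    have y3 := h2 1 1 2
    have w1 := h2 2 0 1
    have w2 := h2 2 0 2
    have w3 := h2 2 1 2
    simp [l10, l02, l21, s1, s2, s3] at z1 z2 z3 x1 x2 x3 y1 y2 y3 w1 w2 w3
    intro a
    fin_cases a <;> simp only [Fin.zero_eta, Fin.mk_one, Fin.reduceFinMk, b0, h3,
      c001, c002, c010, c012, c020, c021, c101, c102, c110, c112, c120, c121,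
      c201, c202, c210, c212, c220, c221, d00, d01, d02, d10, d11, d12, d20, d21, d22,
      d00', d01', d02', d10', d11', d12', d20', d21', d22', l10, l02, l21] <;>
      refine ⟨?_, ?_, ?_⟩ <;>
      linarith only [x1, x2, x3, y1, y2, y3, w1, w2, w3, z1, z2, z3]
end

/-! ### The exterior derivative of a wedge product. -/

section
variable {E : Type*} [NormedAddCommGroup E] [NormedSpace ℝ E]

lemma wedge_apply (α β : E →L[ℝ] ℝ) (v : Fin 2 → E) :
    wedge α β v = α (v 0) * β (v 1) - α (v 1) * β (v 0) := rfl

lemma isBoundedBilinearMap_wedge :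
    IsBoundedBilinearMap ℝ (fun p : (E →L[ℝ] ℝ) × (E →L[ℝ] ℝ) ↦ wedge p.1 p.2) where
  add_left a b c := by ext v; simp [wedge_apply]; ring
  smul_left r a b := by ext v; simp [wedge_apply]; ring
  add_right a b c := by ext v; simp [wedge_apply]; ring
  smul_right r a b := by ext v; simp [wedge_apply]; ring
  bound := by
    refine ⟨2, two_pos, fun α β ↦
      ContinuousAlternatingMap.opNorm_le_bound (wedge α β) (M := 2 * ‖α‖ * ‖β‖) (by positivity)
        fun v ↦ ?_⟩
    rw [Fin.prod_univ_two]
    refine (norm_sub_le _ _).trans ?_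
    rw [norm_mul, norm_mul]
    have h1 := mul_le_mul (α.le_opNorm (v 0)) (β.le_opNorm (v 1)) (norm_nonneg _) (by positivity)
    have h2 := mul_le_mul (α.le_opNorm (v 1)) (β.le_opNorm (v 0)) (norm_nonneg _) (by positivity)
    calc _ ≤ _ := add_le_add h1 h2
      _ = _ := by ring

lemma DifferentiableAt.wedge {F : Type*} [NormedAddCommGroup F] [NormedSpace ℝ F]
    {a b : F → E →L[ℝ] ℝ} {y : F} (ha : DifferentiableAt ℝ a y) (hb : DifferentiableAt ℝ b y) :
    DifferentiableAt ℝ (fun z ↦ wedge (a z) (b z)) y :=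
  DifferentiableAt.comp (g := fun p : (E →L[ℝ] ℝ) × (E →L[ℝ] ℝ) ↦ _root_.wedge p.1 p.2) y
    (isBoundedBilinearMap_wedge.differentiableAt (a y, b y)) (ha.prodMk hb)

lemma ContDiffAt.wedge {F : Type*} [NormedAddCommGroup F] [NormedSpace ℝ F] {n : ℕ∞ω}
    {a b : F → E →L[ℝ] ℝ} {y : F} (ha : ContDiffAt ℝ n a y) (hb : ContDiffAt ℝ n b y) :
    ContDiffAt ℝ n (fun z ↦ wedge (a z) (b z)) y :=
  ContDiffAt.comp (g := fun p : (E →L[ℝ] ℝ) × (E →L[ℝ] ℝ) ↦ _root_.wedge p.1 p.2) y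
    isBoundedBilinearMap_wedge.contDiff.contDiffAt (ha.prodMk hb)

/-- The Leibniz rule `d(a ∧ b) = da ∧ b - a ∧ db`, with both products written as cyclic sums over
`u, v, w`. -/
lemma extDeriv_wedge {a b : E → E →L[ℝ] ℝ} {y : E} (ha : DifferentiableAt ℝ a y)
    (hb : DifferentiableAt ℝ b y) (u v w : E) :
    extDeriv (fun z ↦ wedge (a z) (b z)) y ![u, v, w] =
      ((fderiv ℝ a y u v - fderiv ℝ a y v u) * b y w +
        (fderiv ℝ a y v w - fderiv ℝ a y w v) * b y u +
        (fderiv ℝ a y w u - fderiv ℝ a y u w) * b y v) -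
      (a y w * (fderiv ℝ b y u v - fderiv ℝ b y v u) +
        a y u * (fderiv ℝ b y v w - fderiv ℝ b y w v) +
        a y v * (fderiv ℝ b y w u - fderiv ℝ b y u w)) := by
  rw [extDeriv_apply (ha.wedge hb)]
  have h2 : ∀ (s : Fin 2 → E) (r : E), fderiv ℝ (fun z ↦ wedge (a z) (b z) s) y r =
      fderiv ℝ a y r (s 0) * b y (s 1) + a y (s 0) * fderiv ℝ b y r (s 1) -
      (fderiv ℝ a y r (s 1) * b y (s 0) + a y (s 1) * fderiv ℝ b y r (s 0)) := by
    intro s r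
    have ha' := fun x : E ↦ ha.hasFDerivAt.clm_apply (hasFDerivAt_const x y)
    have hb' := fun x : E ↦ hb.hasFDerivAt.clm_apply (hasFDerivAt_const x y)
    have := (((ha' (s 0)).mul (hb' (s 1))).sub ((ha' (s 1)).mul (hb' (s 0)))).fderiv
    refine (DFunLike.congr_fun this r).trans ?_
    simp
    ring
  simp only [h2]
  simp [Fin.sum_univ_three, Fin.removeNth, Fin.succAbove]
  ring

end

section
variable {E : Type*} [NormedAddCommGroup E] [NormedSpace ℝ E]
  {H : Type*} [TopologicalSpace H] {I : ModelWithCorners ℝ E H}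
  {M : Type*} [TopologicalSpace M] [ChartedSpace H M] [IsManifold I ∞ M] [I.Boundaryless]

lemma mextDeriv_wedge_eq_extDeriv (α β : ∀ x : M, TangentSpace I x →L[ℝ] ℝ) (x₀ : M)
    (v : Fin 3 → TangentSpace I x₀) :
    mextDeriv I (fun x ↦ wedge (α x) (β x)) x₀ v =
      extDeriv (fun y ↦ wedge (chartForm I x₀ α y) (chartForm I x₀ β y)) (extChartAt I x₀ x₀) v := by
  rw [mextDeriv_apply_eq_extDeriv]
  rfl

lemma mextDeriv_wedge {α β : ∀ x : M, TangentSpace I x →L[ℝ] ℝ} (hα : SmoothOneForm I α)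
    (hβ : SmoothOneForm I β) (x : M) (u v w : TangentSpace I x) :
    mextDeriv I (fun x ↦ wedge (α x) (β x)) x ![u, v, w] =
      (mextDeriv I (fun x ↦ toOneForm (α x)) x ![u, v] * β x w +
        mextDeriv I (fun x ↦ toOneForm (α x)) x ![v, w] * β x u +
        mextDeriv I (fun x ↦ toOneForm (α x)) x ![w, u] * β x v) -
      (α x w * mextDeriv I (fun x ↦ toOneForm (β x)) x ![u, v] +
        α x u * mextDeriv I (fun x ↦ toOneForm (β x)) x ![v, w] +
        α x v * mextDeriv I (fun x ↦ toOneForm (β x)) x ![w, u]) := by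
  have hα' := hα.differentiableAt_chartForm x
  have hβ' := hβ.differentiableAt_chartForm x
  rw [mextDeriv_wedge_eq_extDeriv]
  refine (extDeriv_wedge hα' hβ' u v w).trans ?_
  simp only [mextDeriv_toOneForm hα', mextDeriv_toOneForm hβ']
  have a1 := chartForm_extChartAt_self α x
  have b1 := chartForm_extChartAt_self β x
  rw [← a1 u, ← a1 v, ← a1 w, ← b1 u, ← b1 v, ← b1 w]
end

/-! ### Structure functions of the frame on `G × I` and the pointwise criterion. -/

section
variable {E : Type*} [AddCommGroup E] [Module ℝ E] [TopologicalSpace E]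

lemma exists_dual_basis {n : ℕ} [NeZero n] (hn : Module.finrank ℝ E = n) {ε : Fin n → E →L[ℝ] ℝ}
    {u : Fin n → E} (h : ∀ i j, ε i (u j) = if i = j then 1 else 0) :
    ∃ b : Module.Basis (Fin n) ℝ E, ∀ i, b i = u i := by
  have hli : LinearIndependent ℝ u := by
    rw [Fintype.linearIndependent_iff]
    intro c hc i
    have := congrArg (ε i) hc
    rw [map_sum, map_zero] at this
    simpa [h] using this
  exact ⟨basisOfLinearIndependentOfCardEqFinrank hli (by simp [hn]), fun i ↦ by simp⟩

end

section
variable {G : Type*} [TopologicalSpace G] [ChartedSpace (EuclideanSpace ℝ (Fin 3)) G] {I : Opens ℝ}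
  {e : Fin 3 → ℝ → ∀ x : G, TangentSpace (𝓡 3) x →L[ℝ] ℝ} {f : ℝ → ℝ}
  {X : Fin 4 → ∀ p : G × I, TangentSpace ((𝓡 3).prod 𝓘(ℝ, ℝ)) p}

lemma evolutionCoframe_castSucc (k : Fin 3) :
    evolutionCoframe (I := I) e f k.castSucc = pullOneForm (e k) := by
  fin_cases k <;> rfl

lemma evolutionCoframe_three : evolutionCoframe (I := I) e f 3 = timeForm f := rfl

variable [IsManifold (𝓡 3) ∞ G]

/-- Pairings of the frame with the coframe are constant, so Cartan's formula leaves `-dθ(X_a, X_b)`;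
then `dθ` is split into its part on `G` and its time part. -/
lemma IsSmoothFrame.bracketCoeff_castSucc (h : IsSmoothFrame (evolutionCoframe e f) X)
    (he : IsSmoothCoframe I e) (a b : Fin 4) (k : Fin 3) (q : G × I) :
    bracketCoeff (evolutionCoframe e f) X a b k.castSucc q =
      -(mextDeriv (𝓡 3) (fun y ↦ toOneForm (e k q.2 y)) q.1 ![(X a q).1, (X b q).1] +
        (X a q).2 * deriv (fun s ↦ e k s q.1 (X b q).1) q.2 -
        (X b q).2 * deriv (fun s ↦ e k s q.1 (X a q).1) q.2) := by
  have h0 : ∀ c, mvfderiv ((𝓡 3).prod 𝓘(ℝ, ℝ)) (fun p ↦ evolutionCoframe e f k.castSucc p (X c p)) q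
      = 0 := by
    intro c
    simp only [h.apply_frame]
    exact mvfderiv_const ..
  have h1 := (h.smooth_coframe k.castSucc).apply_mlieBracket (h.mdifferentiableAt_frame a q)
    (h.mdifferentiableAt_frame b q)
  rw [h0, h0, evolutionCoframe_castSucc] at h1
  rw [bracketCoeff, evolutionCoframe_castSucc]
  refine h1.trans ?_
  have h4 := mextDeriv_toOneForm ((he.smoothOneForm k q.2.2).differentiableAt_chartForm q.1)
    (X a q).1 (X b q).1
  have h2 := he.fderiv_chartForm_pullOneForm k q (X a q) (X b q)
  have h3 := he.fderiv_chartForm_pullOneForm k q (X b q) (X a q)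
  have key : ∀ a a' b b' c d m : ℝ, a = b + c → a' = b' + d → m = b - b' →
      0 - 0 - (a - a') = -(m + c - d) := by
    intros; subst_vars; ring
  exact key _ _ _ _ _ _ _ h2 h3 h4

lemma IsSmoothFrame.bracketCoeff_three (h : IsSmoothFrame (evolutionCoframe e f) X)
    (hf : ContDiffOn ℝ ∞ f I) (a b : Fin 4) (q : G × I) :
    bracketCoeff (evolutionCoframe e f) X a b 3 q = 0 := by
  have h0 : ∀ c, mvfderiv ((𝓡 3).prod 𝓘(ℝ, ℝ)) (fun p ↦ evolutionCoframe e f 3 p (X c p)) q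
      = 0 := by
    intro c
    simp only [h.apply_frame]
    exact mvfderiv_const ..
  have h1 := (h.smooth_coframe 3).apply_mlieBracket (h.mdifferentiableAt_frame a q)
    (h.mdifferentiableAt_frame b q)
  rw [h0, h0, evolutionCoframe_three] at h1
  rw [bracketCoeff, evolutionCoframe_three]
  refine h1.trans ?_
  have h2 := fderiv_chartForm_timeForm hf q (X a q) (X b q)
  have h3 := fderiv_chartForm_timeForm hf q (X b q) (X a q)
  have key : ∀ a a' b c d : ℝ, a = b * c * d → a' = d * c * b → 0 - 0 - (a - a') = 0 := by
    intros; subst_vars; ring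
  exact key _ _ _ _ _ h2 h3

lemma IsSmoothFrame.apply_fst (h : IsSmoothFrame (evolutionCoframe e f) X) (k : Fin 3) (a : Fin 4)
    (q : G × I) : e k q.2 q.1 (X a q).1 = if k.castSucc = a then 1 else 0 := by
  rw [← h.apply_frame, evolutionCoframe_castSucc, pullOneForm_apply]

lemma IsSmoothFrame.apply_snd (h : IsSmoothFrame (evolutionCoframe e f) X) (a : Fin 4)
    (q : G × I) : f q.2 * (X a q).2 = if 3 = a then 1 else 0 := by
  rw [← h.apply_frame, evolutionCoframe_three, timeForm_apply]

/-- All `e^k` annihilate the `G`-component of `X 3`, so `X 3` is a multiple of `∂_t`. -/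
lemma IsSmoothFrame.fst_three (h : IsSmoothFrame (evolutionCoframe e f) X)
    (he : IsSmoothCoframe I e) (q : G × I) : ((X 3 q).1 : EuclideanSpace ℝ (Fin 3)) = 0 := by
  have hinj := (isInvertible_pi_of_linearIndependent (E := EuclideanSpace ℝ (Fin 3)) (by simp)
    (he.basis q.2 q.2.2 q.1))
  obtain ⟨L, hL⟩ := hinj
  apply L.injective
  rw [map_zero]
  funext k
  have := DFunLike.congr_fun hL (X 3 q).1
  refine (congrFun this k).trans ?_
  refine (h.apply_fst k 3 q).trans ?_
  rw [if_neg (show k.castSucc ≠ 3 from (Fin.castSucc_lt_last k).ne)]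
  rfl

lemma IsSmoothCoframe.exists_hasDerivAt (he : IsSmoothCoframe I e) (k : Fin 3) {t : ℝ}
    (ht : t ∈ I) (x : G) : ∃ D : TangentSpace (𝓡 3) x →L[ℝ] ℝ,
      ∀ v, HasDerivAt (fun s ↦ e k s x v) (D v) t := by
  have h := (he.contDiffAt_chartForm k x (mem_extChartAt_target (I := 𝓡 3) x) ht).differentiableAt
    (by simp)
  have h1 : HasDerivAt (fun s : ℝ ↦ (extChartAt (𝓡 3) x x, s))
    ((0 : EuclideanSpace ℝ (Fin 3)), (1 : ℝ)) t := (hasDerivAt_const _ _).prodMk (hasDerivAt_id _)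
  have h2 := h.hasFDerivAt.comp_hasDerivAt t h1
  let D := fderiv ℝ (fun z : EuclideanSpace ℝ (Fin 3) × ℝ ↦ chartForm (𝓡 3) x (e k z.2) z.1)
    (extChartAt (𝓡 3) x x, t) (0, 1)
  have h3 : ∀ v : EuclideanSpace ℝ (Fin 3),
      HasDerivAt (fun s ↦ chartForm (𝓡 3) x (e k s) (extChartAt (𝓡 3) x x) v) (D v) t := fun v ↦
    (h2.clm_apply (hasDerivAt_const t v)).congr_deriv (by simp [D])
  exact ⟨D, fun v ↦ (h3 v).congr_of_eventuallyEq (Filter.Eventually.of_forall fun s ↦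
    (chartForm_extChartAt_self (I := 𝓡 3) (e k s) x v).symm)⟩

end

section
variable {V : Type*} [AddCommGroup V] [Module ℝ V] [TopologicalSpace V]

lemma ContinuousAlternatingMap.ext_basis_two {ι : Type*} (b : Module.Basis ι ℝ V)
    {A A' : V [⋀^Fin 2]→L[ℝ] ℝ} (h : ∀ i j, A ![b i, b j] = A' ![b i, b j]) : A = A' := by
  apply ContinuousAlternatingMap.toAlternatingMap_injective
  refine b.ext_alternating fun v _ ↦ ?_
  have e : (fun i ↦ b (v i)) = ![b (v 0), b (v 1)] := by
    funext i
    fin_cases i <;> rfl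
  rw [e]
  exact h _ _

/-- An injective choice of three indices out of three is a permutation, so a single value determines
the form. -/
lemma ContinuousAlternatingMap.eq_zero_of_basis_three (b : Module.Basis (Fin 3) ℝ V)
    {A : V [⋀^Fin 3]→L[ℝ] ℝ} (h : A ![b 0, b 1, b 2] = 0) : A = 0 := by
  apply ContinuousAlternatingMap.toAlternatingMap_injective
  refine b.ext_alternating fun v hv ↦ ?_
  let σ : Equiv.Perm (Fin 3) := Equiv.ofBijective v (Finite.injective_iff_bijective.1 hv)
  have e : (b : Fin 3 → V) = ![b 0, b 1, b 2] := by
    funext i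
    fin_cases i <;> rfl
  have := A.toAlternatingMap.map_perm b σ
  refine this.trans ?_
  rw [e]
  exact (congrArg (_ • ·) h).trans (smul_zero _)

end

section
variable {G : Type*} [TopologicalSpace G] [ChartedSpace (EuclideanSpace ℝ (Fin 3)) G] {I : Opens ℝ}
  {e : Fin 3 → ℝ → ∀ x : G, TangentSpace (𝓡 3) x →L[ℝ] ℝ} {f : ℝ → ℝ}
  {X : Fin 4 → ∀ p : G × I, TangentSpace ((𝓡 3).prod 𝓘(ℝ, ℝ)) p}

variable [IsManifold (𝓡 3) ∞ G]

lemma IsSmoothFrame.exists_basis_fst (h : IsSmoothFrame (evolutionCoframe e f) X) (q : G × I) :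
    ∃ b : Module.Basis (Fin 3) ℝ (TangentSpace (𝓡 3) q.1), ∀ i, b i = (X i.castSucc q).1 := by
  have hn : Module.finrank ℝ (EuclideanSpace ℝ (Fin 3)) = 3 := by simp
  refine exists_dual_basis (E := TangentSpace (𝓡 3) q.1) hn
    (ε := fun k ↦ e k q.2 q.1) (fun i j ↦ ?_)
  exact (h.apply_fst i j.castSucc q).trans (by simp)

/-- A 3-form in dimension three has one component, here expanded by the Leibniz rule into the form
that `structure_equations_iff` produces. -/
lemma mextDeriv_wedge_eq_zero_iff (he : IsSmoothCoframe I e) {t : ℝ} (ht : t ∈ I) (x : G)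
    (i j : Fin 3) (b : Module.Basis (Fin 3) ℝ (TangentSpace (𝓡 3) x))
    (hb : ∀ k a, e k t x (b a) = if k = a then 1 else 0) :
    mextDeriv (𝓡 3) (fun y ↦ wedge (e i t y) (e j t y)) x = 0 ↔
      (mextDeriv (𝓡 3) (fun y ↦ toOneForm (e i t y)) x ![b 0, b 1] * (if j = 2 then 1 else 0) +
        mextDeriv (𝓡 3) (fun y ↦ toOneForm (e i t y)) x ![b 1, b 2] * (if j = 0 then 1 else 0) +
        mextDeriv (𝓡 3) (fun y ↦ toOneForm (e i t y)) x ![b 2, b 0] * (if j = 1 then 1 else 0)) -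
      ((if i = 2 then 1 else 0) * mextDeriv (𝓡 3) (fun y ↦ toOneForm (e j t y)) x ![b 0, b 1] +
        (if i = 0 then 1 else 0) * mextDeriv (𝓡 3) (fun y ↦ toOneForm (e j t y)) x ![b 1, b 2] +
        (if i = 1 then 1 else 0) * mextDeriv (𝓡 3) (fun y ↦ toOneForm (e j t y)) x ![b 2, b 0])
        = 0 := by
  have key := mextDeriv_wedge (he.smoothOneForm i ht) (he.smoothOneForm j ht) x (b 0) (b 1) (b 2)
  simp only [hb] at key
  rw [← key]
  refine ⟨fun h ↦ by rw [h]; rfl, fun h ↦ ContinuousAlternatingMap.eq_zero_of_basis_three b h⟩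

lemma hasDerivAt_wedge {V : Type*} [AddCommGroup V] [Module ℝ V] [TopologicalSpace V]
    {α β : ℝ → V →L[ℝ] ℝ} {A B : V →L[ℝ] ℝ} {t : ℝ}
    (hα : ∀ v, HasDerivAt (fun s ↦ α s v) (A v) t) (hβ : ∀ v, HasDerivAt (fun s ↦ β s v) (B v) t)
    (v w : V) : HasDerivAt (fun s ↦ wedge (α s) (β s) ![v, w])
      ((A v * β t w - A w * β t v) + (α t v * B w - α t w * B v)) t :=
  (((hα v).mul (hβ w)).sub ((hα w).mul (hβ v))).congr_deriv (by ring)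

/-- Both sides are 2-forms in `v, w`, so equality may be tested on pairs of basis vectors; dividing
by `f t` gives the form in `structure_equations_iff`. -/
lemma evolution_iff (he : IsSmoothCoframe I e) {t : ℝ} (ht : t ∈ I) (hft : f t ≠ 0) (x : G)
    (i : Fin 3) (b : Module.Basis (Fin 3) ℝ (TangentSpace (𝓡 3) x))
    (hb : ∀ k a, e k t x (b a) = if k = a then 1 else 0) :
    (∀ v w : TangentSpace (𝓡 3) x, HasDerivAt (fun s ↦ wedge (e i s x) (e (i + 1) s x) ![v, w])
      (-(f t * mextDeriv (𝓡 3) (fun y ↦ toOneForm (e (i + 2) t y)) x ![v, w])) t) ↔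
    ∀ a c : Fin 3, ((f t)⁻¹ * deriv (fun s ↦ e i s x (b a)) t * (if i + 1 = c then 1 else 0) -
        (f t)⁻¹ * deriv (fun s ↦ e i s x (b c)) t * (if i + 1 = a then 1 else 0)) +
      ((if i = a then 1 else 0) * ((f t)⁻¹ * deriv (fun s ↦ e (i + 1) s x (b c)) t) -
        (if i = c then 1 else 0) * ((f t)⁻¹ * deriv (fun s ↦ e (i + 1) s x (b a)) t)) =
      -mextDeriv (𝓡 3) (fun y ↦ toOneForm (e (i + 2) t y)) x ![b a, b c] := by
  obtain ⟨A, hA⟩ := he.exists_hasDerivAt i ht x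
  obtain ⟨B, hB⟩ := he.exists_hasDerivAt (i + 1) ht x
  have hd := hasDerivAt_wedge hA hB
  have key : ∀ p q r s m φ : ℝ, φ ≠ 0 → ∀ a b c d : ℝ,
      ((p * a - q * b) + (c * r - d * s) = -(φ * m) ↔
        (φ⁻¹ * p * a - φ⁻¹ * q * b) + (c * (φ⁻¹ * r) - d * (φ⁻¹ * s)) = -m) := by
    intro p q r s m φ hφ a b c d
    field_simp
  have h1 : (∀ v w : TangentSpace (𝓡 3) x, HasDerivAt (fun s ↦ wedge (e i s x) (e (i + 1) s x) ![v, w])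
      (-(f t * mextDeriv (𝓡 3) (fun y ↦ toOneForm (e (i + 2) t y)) x ![v, w])) t) ↔
      ∀ a c, (wedge A (e (i + 1) t x) + wedge (e i t x) B) ![b a, b c] =
        (-(f t) • mextDeriv (𝓡 3) (fun y ↦ toOneForm (e (i + 2) t y)) x) ![b a, b c] := by
    constructor
    · intro h a c
      refine ((hd (b a) (b c)).unique (h (b a) (b c))).trans (neg_mul _ _).symm
    · intro h v w
      have := ContinuousAlternatingMap.ext_basis_two b h
      refine (hd v w).congr_deriv ?_
      exact (DFunLike.congr_fun this ![v, w]).trans (neg_mul _ _)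
  rw [h1]
  refine forall_congr' fun a ↦ forall_congr' fun c ↦ ?_
  rw [← key _ _ _ _ _ _ hft, (hA _).deriv, (hA _).deriv, (hB _).deriv, (hB _).deriv, ← hb, ← hb,
    ← hb, ← hb]
  exact ⟨fun h ↦ h.trans (neg_mul _ _), fun h ↦ h.trans (neg_mul _ _).symm⟩

/-- Apply `structure_equations_iff` with `C` the values of `de^k` and `D` those of `f⁻¹ ∂_t e^k` on
the basis of the tangent space of `G` given by `X 0, X 1, X 2`; the factor `f⁻¹` is the time
component of `X 3`. -/
lemma IsSmoothFrame.koszulCoeff_commute_iff (h : IsSmoothFrame (evolutionCoframe e f) X)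
    (he : IsSmoothCoframe I e) (hf : ContDiffOn ℝ ∞ f I) (hf0 : ∀ t ∈ I, f t ≠ 0) (q : G × I) :
    (∀ s a b c, ∑ d, koszulCoeff (evolutionCoframe e f) X a d c q * hyperMatrix s d b =
      ∑ d, hyperMatrix s c d * koszulCoeff (evolutionCoframe e f) X a b d q) ↔
    (∀ i j, mextDeriv (𝓡 3) (fun y ↦ wedge (e i q.2 y) (e j q.2 y)) q.1 = 0) ∧
    ∀ i, ∀ v w : TangentSpace (𝓡 3) q.1,
      HasDerivAt (fun s ↦ wedge (e i s q.1) (e (i + 1) s q.1) ![v, w])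
        (-(f q.2 * mextDeriv (𝓡 3) (fun y ↦ toOneForm (e (i + 2) q.2 y)) q.1 ![v, w])) q.2 := by
  obtain ⟨b, hb⟩ := h.exists_basis_fst q
  have hft := hf0 q.2 q.2.2
  have hbe : ∀ k a, e k q.2 q.1 (b a) = if k = a then 1 else 0 := fun k a ↦
    (congrArg (e k q.2 q.1) (hb a)).trans ((h.apply_fst k a.castSucc q).trans (by simp))
  have hsnd : ∀ a : Fin 3, (X a.castSucc q).2 = 0 := fun a ↦ by
    have := h.apply_snd a.castSucc q
    rw [if_neg (show (3 : Fin 4) ≠ a.castSucc from (Fin.castSucc_lt_last a).ne')] at this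
    exact (mul_eq_zero.1 this).resolve_left hft
  have hsnd3 : (X 3 q).2 = (f q.2)⁻¹ := by
    have := h.apply_snd 3 q
    rw [if_pos rfl] at this
    exact (eq_inv_of_mul_eq_one_right this)
  have hmz : ∀ k (v : TangentSpace (𝓡 3) q.1),
      mextDeriv (𝓡 3) (fun y ↦ toOneForm (e k q.2 y)) q.1 ![(X 3 q).1, v] = 0 := fun k v ↦
    ContinuousAlternatingMap.map_coord_zero _ 0 (h.fst_three he q)
  have key := structure_equations_iff (B := fun a b c ↦ bracketCoeff (evolutionCoframe e f) X a b c q)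
    (C := fun k a c ↦ mextDeriv (𝓡 3) (fun y ↦ toOneForm (e k q.2 y)) q.1 ![b a, b c])
    (D := fun k a ↦ (f q.2)⁻¹ * deriv (fun s ↦ e k s q.1 (b a)) q.2)
    (fun a b c ↦ bracketCoeff_swap b a c q)
    (fun k a c ↦ by
      rw [h.bracketCoeff_castSucc he, hsnd, hsnd, hb, hb]
      ring)
    (fun k a ↦ by
      rw [h.bracketCoeff_castSucc he, hsnd, hsnd3, hb]
      have key : ∀ m φ d z : ℝ, m = 0 → -(m + φ * d - 0 * z) = -(φ * d) := by
        intros; subst_vars; ring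
      exact key _ _ _ _ (hmz k _))
    (fun a b ↦ h.bracketCoeff_three hf a b q)
  refine key.trans ?_
  refine and_congr ?_ ?_
  · exact forall_congr' fun i ↦ forall_congr' fun j ↦
      (mextDeriv_wedge_eq_zero_iff he q.2.2 q.1 i j b hbe).symm
  · exact forall_congr' fun i ↦ (evolution_iff he q.2.2 hft q.1 i b hbe).symm

end

/-! ### Chart independence of the exterior derivative of a 1-form. -/

section
variable {E : Type*} [NormedAddCommGroup E] [NormedSpace ℝ E]
  {H : Type*} [TopologicalSpace H] {I : ModelWithCorners ℝ E H}
  {M : Type*} [TopologicalSpace M] [ChartedSpace H M] [IsManifold I ∞ M] [I.Boundaryless]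

lemma contMDiffAt_extChartAt_symm (x₀ : M) {y : E} (hy : y ∈ (extChartAt I x₀).target) :
    ContMDiffAt 𝓘(ℝ, E) I ∞ (extChartAt I x₀).symm y :=
  (contMDiffOn_extChartAt_symm x₀).contMDiffAt ((isOpen_extChartAt_target x₀).mem_nhds hy)

/-- The coordinate expressions of a 1-form in two charts are related by pullback. -/
lemma chartForm_eq_comp_fderiv (α : ∀ x : M, TangentSpace I x →L[ℝ] ℝ) (x₀ x₁ : M) {z : E}
    (hz : z ∈ (extChartAt I x₀).target)
    (hz' : (extChartAt I x₀).symm z ∈ (extChartAt I x₁).source) :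
    chartForm I x₀ α z = (chartForm I x₁ α (extChartAt I x₁ ((extChartAt I x₀).symm z))).comp
      (fderiv ℝ (extChartAt I x₁ ∘ (extChartAt I x₀).symm) z) := by
  have d0 := (contMDiffAt_extChartAt_symm x₀ hz).mdifferentiableAt (by simp)
  have d1 : MDifferentiableAt I 𝓘(ℝ, E) (extChartAt I x₁) ((extChartAt I x₀).symm z) :=
    mdifferentiableAt_extChartAt (by rwa [extChartAt_source] at hz')
  have hψ : MDifferentiableAt 𝓘(ℝ, E) 𝓘(ℝ, E) (extChartAt I x₁ ∘ (extChartAt I x₀).symm) z :=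
    d1.comp z d0
  have d2 := (contMDiffAt_extChartAt_symm x₁ ((extChartAt I x₁).map_source hz')).mdifferentiableAt
    (by simp)
  have c := mfderiv_comp z (g := (extChartAt I x₁).symm)
    (f := extChartAt I x₁ ∘ (extChartAt I x₀).symm) d2 hψ
  have e1 : (extChartAt I x₁).symm ∘ (extChartAt I x₁ ∘ (extChartAt I x₀).symm) =ᶠ[nhds z]
      (extChartAt I x₀).symm := by
    filter_upwards [d0.continuousAt.preimage_mem_nhds
      ((isOpen_extChartAt_source x₁).mem_nhds hz')] with w hw
    exact (extChartAt I x₁).left_inv hw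
  have c' := e1.mfderiv_eq.symm.trans c
  ext v
  have hr : range I = univ := I.range_eq_univ
  have c5 : (mfderivWithin 𝓘(ℝ, E) I (extChartAt I x₀).symm (range I) z v : E) =
      mfderivWithin 𝓘(ℝ, E) I (extChartAt I x₁).symm (range I)
        (extChartAt I x₁ ((extChartAt I x₀).symm z))
        (fderiv ℝ (extChartAt I x₁ ∘ (extChartAt I x₀).symm) z v) := by
    rw [hr, mfderivWithin_univ, mfderivWithin_univ, ← mfderiv_eq_fderiv]
    exact DFunLike.congr_fun c' v
  have key : ∀ x x' : M, x = x' → ∀ u u' : E, u = u' → α x u = α x' u' := by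
    rintro _ _ rfl _ _ rfl; rfl
  exact key _ _ ((extChartAt I x₁).left_inv hz').symm _ _ c5

/-- `mextDeriv` at a point uses the chart centred there, whereas a second exterior derivative needs
one fixed chart on a neighbourhood. The two are compared by pulling back along the transition map
`ψ`, with which `extDeriv` commutes. -/
lemma SmoothOneForm.extDeriv_chartForm {α : ∀ x : M, TangentSpace I x →L[ℝ] ℝ}
    (hα : SmoothOneForm I α) (x₀ : M) {y : E} (hy : y ∈ (extChartAt I x₀).target) (u v : E) :
    extDeriv (fun z ↦ toOneForm (chartForm I x₀ α z)) y ![u, v] =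
      mextDeriv I (fun x ↦ toOneForm (α x)) ((extChartAt I x₀).symm y)
        ![mfderivWithin 𝓘(ℝ, E) I (extChartAt I x₀).symm (range I) y u,
          mfderivWithin 𝓘(ℝ, E) I (extChartAt I x₀).symm (range I) y v] := by
  set x₁ := (extChartAt I x₀).symm y with hx₁
  let ψ := extChartAt I x₁ ∘ (extChartAt I x₀).symm
  have d0 := contMDiffAt_extChartAt_symm x₀ hy
  have hψ : ContDiffAt ℝ ∞ ψ y := by
    rw [← contMDiffAt_iff_contDiffAt]
    exact (contMDiffAt_extChartAt (x := x₁)).comp y d0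
  have hT : ∀ b : E → E →L[ℝ] ℝ, ∀ z, DifferentiableAt ℝ b z →
      DifferentiableAt ℝ (fun z ↦ toOneForm (b z)) z := fun b z hb ↦
    ((ContinuousAlternatingMap.ofSubsingletonLIE (𝕜 := ℝ) (E := E) (F := ℝ) (0 : Fin 1)
      ).toContinuousLinearEquiv.toContinuousLinearMap.differentiableAt).comp z hb
  have e1 : (fun z ↦ toOneForm (chartForm I x₀ α z)) =ᶠ[nhds y]
      fun z ↦ (toOneForm (chartForm I x₁ α (ψ z))).compContinuousLinearMap (fderiv ℝ ψ z) := by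
    filter_upwards [(isOpen_extChartAt_target x₀).mem_nhds hy,
      d0.continuousAt.preimage_mem_nhds ((isOpen_extChartAt_source x₁).mem_nhds
        (mem_extChartAt_source (I := I) x₁))] with z hz hz'
    rw [chartForm_eq_comp_fderiv α x₀ x₁ hz hz']
    rfl
  have e2 : extDeriv (fun z ↦ (toOneForm (chartForm I x₁ α (ψ z))).compContinuousLinearMap
      (fderiv ℝ ψ z)) y = (extDeriv (fun z ↦ toOneForm (chartForm I x₁ α z))
        (ψ y)).compContinuousLinearMap (fderiv ℝ ψ y) :=
    extDeriv_pullback (r := 2) (f := ψ) (hT _ _ (hα.differentiableAt_chartForm x₁))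
      (contDiffAt_infty.1 hψ 2) (by simp)
  rw [e1.extDeriv_eq, e2]
  have e3 : fderiv ℝ ψ y = mfderivWithin 𝓘(ℝ, E) I (extChartAt I x₀).symm (range I) y := by
    rw [I.range_eq_univ, mfderivWithin_univ, ← mfderiv_eq_fderiv]
    refine (mfderiv_comp y (g := extChartAt I x₁) (f := (extChartAt I x₀).symm)
      (mdifferentiableAt_extChartAt (mem_chart_source H x₁))
      (d0.mdifferentiableAt (by simp))).trans ?_
    ext w
    exact DFunLike.congr_fun (mfderiv_extChartAt_self (𝕜 := ℝ) (I := I) (x := x₁)) _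
  rw [mextDeriv_apply_eq_extDeriv]
  refine congrArg (extDeriv (fun z ↦ toOneForm (chartForm I x₁ α z)) (extChartAt I x₁ x₁)) ?_
  funext i
  fin_cases i
  · exact DFunLike.congr_fun e3 u
  · exact DFunLike.congr_fun e3 v

end

/-! ### Exchanging time and exterior derivatives; propagation of closedness. -/

section
variable {E : Type*} [NormedAddCommGroup E] [NormedSpace ℝ E]
  {F : Type*} [NormedAddCommGroup F] [NormedSpace ℝ F]

/-- The time derivative of the spatial derivative is the spatial derivative of the time
derivative. -/
lemma ContDiffAt.hasDerivAt_fderiv_prod {g : E × ℝ → F} {y₀ : E} {t : ℝ}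
    (hg : ContDiffAt ℝ 2 g (y₀, t)) :
    HasDerivAt (fun s ↦ fderiv ℝ (fun y ↦ g (y, s)) y₀)
      (fderiv ℝ (fun y ↦ deriv (fun s ↦ g (y, s)) t) y₀) t := by
  have hd : ∀ᶠ z in nhds (y₀, t), DifferentiableAt ℝ g z :=
    (hg.eventually (by simp)).mono fun z hz ↦ hz.differentiableAt (by simp)
  have h2 : DifferentiableAt ℝ (fderiv ℝ g) (y₀, t) :=
    (hg.fderiv_right (m := 1) (by norm_num)).differentiableAt (by simp)
  -- Both orders of differentiation are values of the second derivative of `g` on `(0, 1)` and `(u,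
  -- 0)`; its symmetry identifies them.
  have hsymm := hg.isSymmSndFDerivAt (by simp)
  have c1 : Filter.Tendsto (fun s : ℝ ↦ (y₀, s)) (nhds t) (nhds (y₀, t)) :=
    (Continuous.prodMk_right y₀).tendsto t
  have c2 : Filter.Tendsto (fun y : E ↦ (y, t)) (nhds y₀) (nhds (y₀, t)) :=
    (Continuous.prodMk_left t).tendsto y₀
  have e1 : (fun s ↦ fderiv ℝ (fun y ↦ g (y, s)) y₀) =ᶠ[nhds t]
      fun s ↦ (fderiv ℝ g (y₀, s)).comp (ContinuousLinearMap.inl ℝ E ℝ) := by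
    filter_upwards [c1.eventually hd] with s hs
    exact (hs.hasFDerivAt.comp (g := g) y₀ (hasFDerivAt_prodMk_left y₀ s)).fderiv
  have e2 : (fun y ↦ deriv (fun s ↦ g (y, s)) t) =ᶠ[nhds y₀] fun y ↦ fderiv ℝ g (y, t) (0, 1) := by
    filter_upwards [c2.eventually hd] with y hy
    exact (hy.hasFDerivAt.comp_hasDerivAt (l := g) t
      ((hasDerivAt_const t y).prodMk (hasDerivAt_id t))).deriv
  have h3 : HasDerivAt (fun s : ℝ ↦ fderiv ℝ g (y₀, s)) (fderiv ℝ (fderiv ℝ g) (y₀, t) (0, 1)) t :=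
    h2.hasFDerivAt.comp_hasDerivAt t ((hasDerivAt_const t y₀).prodMk (hasDerivAt_id t))
  have h4 := h3.clm_comp (hasDerivAt_const t (ContinuousLinearMap.inl ℝ E ℝ))
  refine (h4.congr_of_eventuallyEq e1).congr_deriv ?_
  have h5 : HasFDerivAt (fun y ↦ fderiv ℝ g (y, t))
      ((fderiv ℝ (fderiv ℝ g) (y₀, t)).comp (ContinuousLinearMap.inl ℝ E ℝ)) y₀ :=
    h2.hasFDerivAt.comp (g := fderiv ℝ g) y₀ (hasFDerivAt_prodMk_left y₀ t)
  rw [e2.fderiv_eq, fderiv_clm_apply h5.differentiableAt (differentiableAt_const _), h5.fderiv]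
  ext u
  simp
  exact hsymm _ _

set_option synthInstance.maxHeartbeats 200000 in
-- `extDeriv` is a fixed continuous linear map, the alternatization, applied to the spatial
-- derivative.
lemma ContDiffAt.hasDerivAt_extDeriv {n : ℕ} {g : E × ℝ → E [⋀^Fin n]→L[ℝ] F} {y₀ : E} {t : ℝ}
    (hg : ContDiffAt ℝ 2 g (y₀, t)) :
    HasDerivAt (fun s ↦ extDeriv (fun y ↦ g (y, s)) y₀)
      (extDeriv (fun y ↦ deriv (fun s ↦ g (y, s)) t) y₀) t :=
  ((ContinuousAlternatingMap.alternatizeUncurryFinCLM ℝ E F (n := n)).hasFDerivAt.comp_hasDerivAt t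
    hg.hasDerivAt_fderiv_prod)

end

section
variable {G : Type*} [TopologicalSpace G] [ChartedSpace (EuclideanSpace ℝ (Fin 3)) G] {I : Opens ℝ}
  {e : Fin 3 → ℝ → ∀ x : G, TangentSpace (𝓡 3) x →L[ℝ] ℝ} {f : ℝ → ℝ} [IsManifold (𝓡 3) ∞ G]

/-- The coordinate form of the evolution equations. -/
lemma IsSmoothCoframe.deriv_wedge_chartForm (he : IsSmoothCoframe I e) {t : ℝ} (ht : t ∈ I)
    (x : G) (i : Fin 3)
    (hev : ∀ (x : G) (v w : TangentSpace (𝓡 3) x),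
      HasDerivAt (fun s ↦ wedge (e i s x) (e (i + 1) s x) ![v, w])
        (-(f t * mextDeriv (𝓡 3) (fun y ↦ toOneForm (e (i + 2) t y)) x ![v, w])) t)
    {y : EuclideanSpace ℝ (Fin 3)} (hy : y ∈ (extChartAt (𝓡 3) x).target) :
    deriv (fun s ↦ wedge (chartForm (𝓡 3) x (e i s) y) (chartForm (𝓡 3) x (e (i + 1) s) y)) t =
      -f t • extDeriv (fun z ↦ toOneForm (chartForm (𝓡 3) x (e (i + 2) t) z)) y := by
  have hA : ∀ k, DifferentiableAt ℝ (fun s ↦ chartForm (𝓡 3) x (e k s) y) t := fun k ↦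
    DifferentiableAt.comp (f := fun s : ℝ ↦ (y, s))
      (g := fun z : EuclideanSpace ℝ (Fin 3) × ℝ ↦ chartForm (𝓡 3) x (e k z.2) z.1) t
      ((he.contDiffAt_chartForm k x hy ht).differentiableAt (by simp)) (by fun_prop)
  have hd := (hA i).wedge (hA (i + 1))
  ext v
  have hv : v = ![v 0, v 1] := by
    funext j
    fin_cases j <;> rfl
  have h1 := hd.hasFDerivAt.continuousAlternatingMap_apply_const v
  have h2 := h1.hasDerivAt
  let m := mfderivWithin 𝓘(ℝ, EuclideanSpace ℝ (Fin 3)) (𝓡 3) (extChartAt (𝓡 3) x).symm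
    (range (𝓡 3)) y
  have h3 := hev ((extChartAt (𝓡 3) x).symm y) (m (v 0)) (m (v 1))
  have h4 := (he.smoothOneForm (i + 2) ht).extDeriv_chartForm x hy (v 0) (v 1)
  have h5 := h2.unique h3
  refine h5.trans ?_
  rw [← h4, ← hv]
  exact (neg_mul _ _).symm

set_option synthInstance.maxHeartbeats 200000 in
-- In the fixed chart at `x`, the time derivative of `de^{ij}` is `d(-f de^k)`. As `f` depends on
-- time only, this is `-f d(de^k) = 0`, so `de^{ij}` at `x` is constant on the connected set `I`.
lemma IsSmoothCoframe.mextDeriv_wedge_eq_zero_of_evolution (he : IsSmoothCoframe I e)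
    (hI : IsPreconnected (I : Set ℝ)) (i : Fin 3)
    (hev : ∀ t ∈ I, ∀ (x : G) (v w : TangentSpace (𝓡 3) x),
      HasDerivAt (fun s ↦ wedge (e i s x) (e (i + 1) s x) ![v, w])
        (-(f t * mextDeriv (𝓡 3) (fun y ↦ toOneForm (e (i + 2) t y)) x ![v, w])) t)
    {t₀ : ℝ} (ht₀ : t₀ ∈ I) (x : G)
    (h₀ : mextDeriv (𝓡 3) (fun y ↦ wedge (e i t₀ y) (e (i + 1) t₀ y)) x = 0)
    {t : ℝ} (ht : t ∈ I) :
    mextDeriv (𝓡 3) (fun y ↦ wedge (e i t y) (e (i + 1) t y)) x = 0 := by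
  let y₀ := extChartAt (𝓡 3) x x
  let g : EuclideanSpace ℝ (Fin 3) × ℝ → EuclideanSpace ℝ (Fin 3) [⋀^Fin 2]→L[ℝ] ℝ := fun z ↦
    wedge (chartForm (𝓡 3) x (e i z.2) z.1) (chartForm (𝓡 3) x (e (i + 1) z.2) z.1)
  have hy₀ : y₀ ∈ (extChartAt (𝓡 3) x).target := mem_extChartAt_target x
  have hder : ∀ s ∈ I, HasDerivAt (fun s ↦ extDeriv (fun y ↦ g (y, s)) y₀) 0 s := by
    intro s hs
    have hg : ContDiffAt ℝ 2 g (y₀, s) := contDiffAt_infty.1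
      ((he.contDiffAt_chartForm i x hy₀ hs).wedge (he.contDiffAt_chartForm (i + 1) x hy₀ hs)) 2
    refine hg.hasDerivAt_extDeriv.congr_deriv ?_
    have e1 : (fun y ↦ deriv (fun s ↦ g (y, s)) s) =ᶠ[nhds y₀]
        -f s • extDeriv (fun z ↦ toOneForm (chartForm (𝓡 3) x (e (i + 2) s) z)) := by
      filter_upwards [(isOpen_extChartAt_target (I := 𝓡 3) x).mem_nhds hy₀] with y hy
      exact he.deriv_wedge_chartForm hs x i (hev s hs) hy
    have hω : ContDiffAt ℝ 2 (fun z ↦ toOneForm (chartForm (𝓡 3) x (e (i + 2) s) z)) y₀ :=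
      (ContinuousAlternatingMap.ofSubsingletonLIE (𝕜 := ℝ) (E := EuclideanSpace ℝ (Fin 3)) (F := ℝ)
        (0 : Fin 1)).contDiff.contDiffAt.comp y₀
          (contDiffAt_infty.1 ((he.smoothOneForm (i + 2) hs x).contDiffAt_chartForm le_rfl) 2)
    rw [e1.extDeriv_eq, extDeriv_smul, extDeriv_extDeriv_apply hω (by simp), smul_zero]
  have hconst := I.isOpen.is_const_of_deriv_eq_zero hI
    (fun s hs ↦ (hder s hs).differentiableAt.differentiableWithinAt)
    (fun s hs ↦ (hder s hs).deriv) ht ht₀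
  ext v
  rw [mextDeriv_wedge_eq_extDeriv]
  refine (DFunLike.congr_fun hconst v).trans ?_
  refine (mextDeriv_wedge_eq_extDeriv (e i t₀) (e (i + 1) t₀) x v).symm.trans ?_
  rw [h₀]

end

/-! ### Uniqueness of the structure with given fundamental forms. -/

section
variable {E : Type*} [NormedAddCommGroup E] [NormedSpace ℝ E]
  {H : Type*} [TopologicalSpace H] {I : ModelWithCorners ℝ E H}
  {M : Type*} [TopologicalSpace M] [ChartedSpace H M] [IsManifold I ∞ M]

lemma ContMDiffRiemannianMetric_eq_of_inner_left
    (g : ContMDiffRiemannianMetric I ∞ E (fun x : M ↦ TangentSpace I x)) {x : M}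
    {u v : TangentSpace I x} (h : ∀ w, g.inner x u w = g.inner x v w) : u = v := by
  by_contra hne
  have h1 := g.pos x (u - v) (sub_ne_zero.2 hne)
  have h2 : g.inner x (u - v) (u - v) = g.inner x u (u - v) - g.inner x v (u - v) :=
    DFunLike.congr_fun (map_sub (g.inner x) u v) (u - v)
  rw [h (u - v), sub_self] at h2
  exact h1.ne' h2

lemma ContMDiffRiemannianMetric_ext
    {g g' : ContMDiffRiemannianMetric I ∞ E (fun x : M ↦ TangentSpace I x)}
    (h : ∀ x v w, g.inner x v w = g'.inner x v w) : g = g' := by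
  have h' : g.inner = g'.inner := by
    funext x
    ext v w
    exact h x v w
  cases g
  cases g'
  congr

/-- An almost hyper-Hermitian structure is determined by its fundamental 2-forms. -/
lemma AlmostHyperHermitian.ext_fundamentalForm {S S' : AlmostHyperHermitian I M}
    (h : ∀ s x v w, S.fundamentalForm s x v w = S'.fundamentalForm s x v w) : S = S' := by
  have h1 : ∀ x v, S.J 1 x v = S'.J 1 x v := by
    intro x v
    -- `F₁(J₂ v, w) = g(J₁ J₂ v, w) = F₃(v, w)` for both structures, so `J₂ v` and `J₂' v` have the
    -- same image under `J₁'`, which is injective.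
    have e : ∀ w, S'.metric.inner x (S'.J 0 x (S.J 1 x v)) w =
        S'.metric.inner x (S'.J 0 x (S'.J 1 x v)) w := by
      intro w
      have a1 := h 0 x (S.J 1 x v) w
      have a2 := h 2 x v w
      simp only [fundamentalForm] at a1 a2
      rw [← a1, S.J_mul, a2, S'.J_mul]
    have e' := congrArg (S'.J 0 x) (ContMDiffRiemannianMetric_eq_of_inner_left S'.metric e)
    rw [S'.J_sq, S'.J_sq] at e'
    exact neg_injective e'
  have hg : ∀ x v w, S.metric.inner x v w = S'.metric.inner x v w := by
    intro x v w
    -- With `J₂` common to both structures, the metric is recovered from `F₂(J₂ v, w) = -g(v, w)`.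
    have a := h 1 x (S.J 1 x v) w
    simp only [fundamentalForm] at a
    rw [S.J_sq, h1, S'.J_sq] at a
    have n : ∀ g : ContMDiffRiemannianMetric I ∞ E (fun x : M ↦ TangentSpace I x),
        g.inner x (-v) w = -g.inner x v w := fun g ↦
      DFunLike.congr_fun (map_neg (g.inner x) v) w
    rw [n, n] at a
    exact neg_injective a
  have hJ : S.J = S'.J := by
    funext s x
    ext v
    refine ContMDiffRiemannianMetric_eq_of_inner_left S.metric fun w ↦ ?_
    rw [hg x (S'.J s x v) w]
    exact h s x v w
  have hm : S.metric = S'.metric := ContMDiffRiemannianMetric_ext hg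
  cases S
  cases S'
  congr

end

/-! ### Existence of the structure and the main theorem. -/

section

lemma hyperMatrix_sq (s : Fin 3) (φ : Fin 4 → ℝ) (i : Fin 4) :
    ∑ b, hyperMatrix s i b * ∑ c, hyperMatrix s b c * φ c = -φ i := by
  fin_cases s <;> fin_cases i <;> simp [hyperMatrix, Fin.sum_univ_four]

lemma hyperMatrix_mul (φ : Fin 4 → ℝ) (i : Fin 4) :
    ∑ b, hyperMatrix 0 i b * ∑ c, hyperMatrix 1 b c * φ c = ∑ c, hyperMatrix 2 i c * φ c := by
  fin_cases i <;> simp [hyperMatrix, Fin.sum_univ_four]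

lemma hyperMatrix_anticomm (φ : Fin 4 → ℝ) (i : Fin 4) :
    ∑ b, hyperMatrix 1 i b * ∑ c, hyperMatrix 0 b c * φ c = -∑ c, hyperMatrix 2 i c * φ c := by
  fin_cases i <;> simp [hyperMatrix, Fin.sum_univ_four]

lemma hyperMatrix_isometry (s : Fin 3) (φ ψ : Fin 4 → ℝ) :
    ∑ i, (∑ b, hyperMatrix s i b * φ b) * (∑ b, hyperMatrix s i b * ψ b) = ∑ i, φ i * ψ i := by
  fin_cases s <;> simp [hyperMatrix, Fin.sum_univ_four] <;> ring

/-- The right-hand sides here and in the next two lemmas have the shape of `wedge` evaluated on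
`![v, w]`, so that `fundamentalForm_eq` holds by unfolding. -/
lemma sum_hyperMatrix_zero (φ ψ : Fin 4 → ℝ) : ∑ i, (∑ b, hyperMatrix 0 i b * φ b) * ψ i =
    (φ 0 * ψ 1 - ψ 0 * φ 1) + (φ 2 * ψ 3 - ψ 2 * φ 3) := by
  simp [hyperMatrix, Fin.sum_univ_four]
  ring

lemma sum_hyperMatrix_one (φ ψ : Fin 4 → ℝ) : ∑ i, (∑ b, hyperMatrix 1 i b * φ b) * ψ i =
    (φ 0 * ψ 2 - ψ 0 * φ 2) - (φ 1 * ψ 3 - ψ 1 * φ 3) := by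
  simp [hyperMatrix, Fin.sum_univ_four]
  ring

lemma sum_hyperMatrix_two (φ ψ : Fin 4 → ℝ) : ∑ i, (∑ b, hyperMatrix 2 i b * φ b) * ψ i =
    (φ 1 * ψ 2 - ψ 1 * φ 2) + (φ 0 * ψ 3 - ψ 0 * φ 3) := by
  simp [hyperMatrix, Fin.sum_univ_four]
  ring

end

section
variable {G : Type*} [TopologicalSpace G] [ChartedSpace (EuclideanSpace ℝ (Fin 3)) G] {I : Opens ℝ}
  {e : Fin 3 → ℝ → ∀ x : G, TangentSpace (𝓡 3) x →L[ℝ] ℝ} {f : ℝ → ℝ} [IsManifold (𝓡 3) ∞ G]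
  {X : Fin 4 → ∀ p : G × I, TangentSpace ((𝓡 3).prod 𝓘(ℝ, ℝ)) p}

/-- The almost hyper-Hermitian structure for which the frame is orthonormal and adapted. -/
noncomputable def IsSmoothFrame.almostHyperHermitian {E : Type*} [NormedAddCommGroup E]
    [NormedSpace ℝ E] {H : Type*} [TopologicalSpace H] {I : ModelWithCorners ℝ E H}
    {M : Type*} [TopologicalSpace M] [ChartedSpace H M] [IsManifold I ∞ M]
    {θ : Fin 4 → ∀ x : M, TangentSpace I x →L[ℝ] ℝ} {X : Fin 4 → ∀ x : M, TangentSpace I x}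
    (h : IsSmoothFrame θ X) : AlmostHyperHermitian I M where
  metric := h.metric
  J s := endo θ X (hyperMatrix s)
  smooth_J s := h.contMDiff_endo _
  J_sq s x v := by
    refine h.ext_of_coframe fun i ↦ ?_
    rw [map_neg]
    simp only [h.apply_endo]
    exact hyperMatrix_sq s (fun c ↦ θ c x v) i
  J_mul x v := by
    refine h.ext_of_coframe fun i ↦ ?_
    simp only [h.apply_endo]
    exact hyperMatrix_mul (fun c ↦ θ c x v) i
  J_anticomm x v := by
    refine h.ext_of_coframe fun i ↦ ?_
    rw [map_neg]
    simp only [h.apply_endo]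
    exact hyperMatrix_anticomm (fun c ↦ θ c x v) i
  isometry s x v w := by
    simp only [h.metric_inner, h.apply_endo]
    exact hyperMatrix_isometry s (fun c ↦ θ c x v) (fun c ↦ θ c x w)

lemma IsSmoothFrame.fundamentalForm_eq (h : IsSmoothFrame (evolutionCoframe e f) X) (s : Fin 3)
    (p : G × I) (v w : TangentSpace ((𝓡 3).prod 𝓘(ℝ, ℝ)) p) :
    h.almostHyperHermitian.fundamentalForm s p v w = evolutionForms e f s p ![v, w] := by
  refine (h.metric_inner p (endo (evolutionCoframe e f) X (hyperMatrix s) p v) w).trans ?_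
  simp only [h.apply_endo]
  fin_cases s
  · exact sum_hyperMatrix_zero (fun c ↦ evolutionCoframe e f c p v) (fun c ↦ evolutionCoframe e f c p w)
  · exact sum_hyperMatrix_one (fun c ↦ evolutionCoframe e f c p v) (fun c ↦ evolutionCoframe e f c p w)
  · exact sum_hyperMatrix_two (fun c ↦ evolutionCoframe e f c p v) (fun c ↦ evolutionCoframe e f c p w)

lemma IsSmoothFrame.metric_inner_eq (h : IsSmoothFrame (evolutionCoframe e f) X)
    (p : G × I) (v w : TangentSpace ((𝓡 3).prod 𝓘(ℝ, ℝ)) p) :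
    h.metric.inner p v w =
      (∑ i, pullOneForm (e i) p v * pullOneForm (e i) p w) + timeForm f p v * timeForm f p w := by
  rw [h.metric_inner, Fin.sum_univ_castSucc]
  simp only [evolutionCoframe_castSucc]
  rfl

lemma mextDeriv_wedge_swap (he : IsSmoothCoframe I e) {t : ℝ} (ht : t ∈ I) (x : G) (i j : Fin 3) :
    mextDeriv (𝓡 3) (fun y ↦ wedge (e j t y) (e i t y)) x =
      -mextDeriv (𝓡 3) (fun y ↦ wedge (e i t y) (e j t y)) x := by
  ext v
  have hv : v = ![v 0, v 1, v 2] := by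
    funext k
    fin_cases k <;> rfl
  have h1 := mextDeriv_wedge (he.smoothOneForm j ht) (he.smoothOneForm i ht) x (v 0) (v 1) (v 2)
  have h2 := mextDeriv_wedge (he.smoothOneForm i ht) (he.smoothOneForm j ht) x (v 0) (v 1) (v 2)
  rw [← hv] at h1 h2
  rw [ContinuousAlternatingMap.neg_apply, h1, h2]
  ring

/-- The pointwise criterion gives both systems at all `(x, t)`; the closedness asserted at one time
extends to all times by the propagation lemma. -/
lemma IsSmoothFrame.isHyperKahler_iff (h : IsSmoothFrame (evolutionCoframe e f) X)
    (he : IsSmoothCoframe I e) (hI : IsConnected (I : Set ℝ)) (hf : ContDiffOn ℝ ∞ f I)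
    (hf0 : ∀ t ∈ I, f t ≠ 0) :
    h.almostHyperHermitian.IsHyperKahler ↔
      (∃ t₀ ∈ I, ∀ i j : Fin 3,
        ∀ x : G, mextDeriv (𝓡 3) (fun y : G ↦ wedge (e i t₀ y) (e j t₀ y)) x = 0) ∧
      (∀ i : Fin 3, ∀ t ∈ I, ∀ (x : G) (v w : TangentSpace (𝓡 3) x),
        HasDerivAt (fun s ↦ wedge (e i s x) (e (i + 1) s x) ![v, w])
          (-(f t * mextDeriv (𝓡 3) (fun y : G ↦ toOneForm (e (i + 2) t y)) x ![v, w])) t) := by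
  have h1 : h.almostHyperHermitian.IsHyperKahler ↔ ∀ q : G × I,
      (∀ i j, mextDeriv (𝓡 3) (fun y ↦ wedge (e i q.2 y) (e j q.2 y)) q.1 = 0) ∧
      ∀ i, ∀ v w : TangentSpace (𝓡 3) q.1,
        HasDerivAt (fun s ↦ wedge (e i s q.1) (e (i + 1) s q.1) ![v, w])
          (-(f q.2 * mextDeriv (𝓡 3) (fun y ↦ toOneForm (e (i + 2) q.2 y)) q.1 ![v, w])) q.2 :=
    (h.exists_isLeviCivita_isParallelEndo_iff hyperMatrix).trans <| forall_comm.trans <|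
      forall_congr' fun q ↦ h.koszulCoeff_commute_iff he hf hf0 q
  rw [h1]
  constructor
  · intro hq
    obtain ⟨t₀, ht₀⟩ := hI.nonempty
    exact ⟨⟨t₀, ht₀, fun i j x ↦ (hq (x, ⟨t₀, ht₀⟩)).1 i j⟩,
      fun i t ht x ↦ (hq (x, ⟨t, ht⟩)).2 i⟩
  · rintro ⟨⟨t₀, ht₀, hc⟩, hev⟩ ⟨x, t, ht⟩
    refine ⟨?_, fun i ↦ hev i t ht x⟩
    -- Modulo 3, each of the nine pairs `(i, j)` is consecutive, reversed consecutive or diagonal.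
    -- Propagation applies to the first kind, and antisymmetry of the wedge settles the others.
    have hnext : ∀ i, mextDeriv (𝓡 3) (fun y ↦ wedge (e i t y) (e (i + 1) t y)) x = 0 := fun i ↦
      he.mextDeriv_wedge_eq_zero_of_evolution hI.isPreconnected i (hev i) ht₀ x (hc _ _ x) ht
    have hprev : ∀ i, mextDeriv (𝓡 3) (fun y ↦ wedge (e (i + 1) t y) (e i t y)) x = 0 := fun i ↦ by
      rw [mextDeriv_wedge_swap he ht, hnext, neg_zero]
    have hself : ∀ i, mextDeriv (𝓡 3) (fun y ↦ wedge (e i t y) (e i t y)) x = 0 := fun i ↦ by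
      ext v
      exact self_eq_neg.1 (DFunLike.congr_fun (mextDeriv_wedge_swap he ht x i i) v)
    intro i j
    fin_cases i <;> fin_cases j
    exacts [hself 0, hnext 0, hprev 2, hprev 0, hself 1, hnext 1, hnext 2, hprev 1, hself 2]

end

theorem mainTheorem1 {G : Type*} [TopologicalSpace G]
    [ChartedSpace (EuclideanSpace ℝ (Fin 3)) G] [Group G] [LieGroup (𝓡 3) ∞ G]
    (I : Opens ℝ) (hI : IsConnected (I : Set ℝ))
    (e : Fin 3 → ℝ → ∀ x : G, TangentSpace (𝓡 3) x →L[ℝ] ℝ) (he : IsSmoothCoframe I e)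
    (f : ℝ → ℝ) (hf : ContDiffOn ℝ ∞ f I) (hf0 : ∀ t ∈ I, f t ≠ 0) :
    (∃! S : AlmostHyperHermitian ((𝓡 3).prod 𝓘(ℝ, ℝ)) (G × I),
      ∀ s p v w, S.fundamentalForm s p v w = evolutionForms e f s p ![v, w]) ∧
    ∀ S : AlmostHyperHermitian ((𝓡 3).prod 𝓘(ℝ, ℝ)) (G × I),
      (∀ s p v w, S.fundamentalForm s p v w = evolutionForms e f s p ![v, w]) →
      (S.IsHyperKahler ↔
        (∃ t₀ ∈ I, ∀ i j : Fin 3,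
          ∀ x : G, mextDeriv (𝓡 3) (fun y : G ↦ wedge (e i t₀ y) (e j t₀ y)) x = 0) ∧
        (∀ i : Fin 3, ∀ t ∈ I, ∀ (x : G) (v w : TangentSpace (𝓡 3) x),
          HasDerivAt (fun s ↦ wedge (e i s x) (e (i + 1) s x) ![v, w])
            (-(f t * mextDeriv (𝓡 3) (fun y : G ↦ toOneForm (e (i + 2) t y)) x ![v, w])) t)) ∧
      (∀ p v w, S.metric.inner p v w =
        (∑ i, pullOneForm (e i) p v * pullOneForm (e i) p w) + timeForm f p v * timeForm f p w) := by
  obtain ⟨X, h⟩ := he.exists_isSmoothFrame hf hf0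
  have huniq : ∀ S : AlmostHyperHermitian ((𝓡 3).prod 𝓘(ℝ, ℝ)) (G × I),
      (∀ s p v w, S.fundamentalForm s p v w = evolutionForms e f s p ![v, w]) →
        S = h.almostHyperHermitian := fun S hS ↦
    AlmostHyperHermitian.ext_fundamentalForm fun s p v w ↦
      (hS s p v w).trans (h.fundamentalForm_eq s p v w).symm
  refine ⟨⟨h.almostHyperHermitian, h.fundamentalForm_eq, huniq⟩, fun S hS ↦ ?_⟩
  rw [huniq S hS]
  exact ⟨h.isHyperKahler_iff he hI hf hf0, h.metric_inner_eq⟩
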